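/- Let $dA$ be Lebesgue area measure on $\mathbb C$. For $1\le p\le\infty$ let $F^p$ be the Fock space of entire functions $f$ such that $f(z)e^{-|z|^2/2}$ is in $L^p(\mathbb C,dA)$. Let $m$ be a positive integer, and let $F^{p,m}$ be the Fock-Sobolev space of entire functions $f$ such that $z^mf(z)$ is in $F^p$, with the norm $$\|f\|_{p,m}=\left[c(p,m)\int_{\mathbb C}\left|z^mf(z)e^{-|z|^2/2}\right|^p\,dA(z)\right]^{1/p}\quad(p<\infty),\qquad \|f\|_{\infty,m}=\sup_{z\in\mathbb C}\left|z^mf(z)e^{-|z|^2/2}\right|,$$ where $c(p,m)=\dfrac{(p/2)^{mp/2+1}}{\pi\,\Gamma(mp/2+1)}$, so that $\|1\|_{p,m}=1$. Suppose $1\le p<\infty$ and $1/p+1/q=1$ (so $q=\infty$ if $p=1$). Then, for $r=p$ and for $r=q$, $F^{r,m}$ is exactly the space of entire functions $f$ whose derivative $f^{(m)}$ is in $F^r$, and the Banach dual of $F^{p,m}$ is identified with $F^{q,m}$ under the integral pairing $$\langle f,g\rangle=\int_{\mathbb C}f(z)\overline{g(z)}\,e^{-|z|^2}|z|^{2m}\,dA(z).$$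 That is, the integral converges absolutely for all $f\in F^{p,m}$ and $g\in F^{q,m}$, and $g\mapsto\langle\,\cdot\,,g\rangle$ is a conjugate-linear bijection from $F^{q,m}$ onto the dual space $(F^{p,m})^*$ of bounded linear functionals which is bounded and has a bounded inverse: the norm of the functional $\langle\,\cdot\,,g\rangle$ is equivalent to $\|g\|_{q,m}$, with constants independent of $g$. -/

import Mathlib

open MeasureTheory
open scoped ENNReal ComplexConjugate

noncomputable section

/-- The function `z ↦ z ^ m * f z * exp (-|z|² / 2)`. -/
def fockWeighted (m : ℕ) (f : ℂ → ℂ) (z : ℂ) : ℂ :=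
  z ^ m * f z * (Real.exp (-‖z‖ ^ 2 / 2) : ℂ)

/-- `f` belongs to the Fock space `F^p`: it is entire and `f z * exp (-|z|² / 2)` is in
`L^p(ℂ, dA)`. -/
def MemFock (p : ℝ≥0∞) (f : ℂ → ℂ) : Prop :=
  Differentiable ℂ f ∧ MemLp (fun z : ℂ => f z * (Real.exp (-‖z‖ ^ 2 / 2) : ℂ)) p volume

/-- `f` is entire and its derivative of order `m` belongs to the Fock space `F^p`. -/
def MemFockSobolev (p : ℝ≥0∞) (m : ℕ) (f : ℂ → ℂ) : Prop :=
  Differentiable ℂ f ∧ MemFock p (iteratedDeriv m f)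

theorem fockWeighted_add (m : ℕ) (f g : ℂ → ℂ) :
    fockWeighted m (f + g) = fockWeighted m f + fockWeighted m g := by
  funext z
  simp only [fockWeighted, Pi.add_apply]
  ring

theorem fockWeighted_smul (m : ℕ) (a : ℂ) (f : ℂ → ℂ) :
    fockWeighted m (a • f) = a • fockWeighted m f := by
  funext z
  simp only [fockWeighted, Pi.smul_apply, smul_eq_mul]
  ring

theorem fockWeighted_zero (m : ℕ) : fockWeighted m 0 = 0 := by
  funext z
  simp [fockWeighted]

/-- The entire functions `f` such that `z ^ m * f z * exp (-|z|² / 2)` is in `L^p(ℂ, dA)`,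
as a linear space of functions. -/
def fockSobolevSubmodule (p : ℝ≥0∞) (m : ℕ) : Submodule ℂ (ℂ → ℂ) where
  carrier := {f | Differentiable ℂ f ∧ MemLp (fockWeighted m f) p volume}
  add_mem' := by
    rintro f g ⟨hf, hf'⟩ ⟨hg, hg'⟩
    refine ⟨hf.add hg, ?_⟩
    rw [fockWeighted_add]
    exact hf'.add hg'
  zero_mem' := by
    refine ⟨differentiable_const (0 : ℂ), ?_⟩
    rw [fockWeighted_zero]
    exact MemLp.zero
  smul_mem' := by
    rintro a f ⟨hf, hf'⟩
    refine ⟨hf.const_smul a, ?_⟩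
    rw [fockWeighted_smul]
    exact hf'.const_smul a

/-- The space `F^{p,m}`. It is a type of its own, so that its topology is the one of the norm
below and not the topology of pointwise convergence. -/
def FockSobolev (p : ℝ≥0∞) (m : ℕ) : Type :=
  ↥(fockSobolevSubmodule p m)

/-- The normalizing factor `c(p,m)^(1/p)`, where
`c(p,m) = (p/2)^(mp/2+1) / (π Γ(mp/2+1))`; there is no normalization for `p = ∞`. -/
def fockConst (p : ℝ≥0∞) (m : ℕ) : ℝ :=
  if p = ∞ then 1 else
    ((p.toReal / 2) ^ (m * p.toReal / 2 + 1) /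
      (Real.pi * Real.Gamma (m * p.toReal / 2 + 1))) ^ (1 / p.toReal)

theorem fockConst_pos (p : ℝ≥0∞) (m : ℕ) (hp : 1 ≤ p) : 0 < fockConst p m := by
  unfold fockConst
  split_ifs with h
  · exact one_pos
  · have h1 : 0 < p.toReal := ENNReal.toReal_pos (one_pos.trans_le hp).ne' h
    have h2 : 0 < Real.Gamma (m * p.toReal / 2 + 1) := Real.Gamma_pos_of_pos (by positivity)
    have h3 := Real.pi_pos
    positivity

namespace FockSobolev

variable {p : ℝ≥0∞} {m : ℕ}

instance : AddCommGroup (FockSobolev p m) :=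
  inferInstanceAs (AddCommGroup ↥(fockSobolevSubmodule p m))

instance : Module ℂ (FockSobolev p m) :=
  inferInstanceAs (Module ℂ ↥(fockSobolevSubmodule p m))

/-- The underlying entire function. -/
def toFun (f : FockSobolev p m) : ℂ → ℂ := f.1

instance : CoeFun (FockSobolev p m) (fun _ => ℂ → ℂ) := ⟨toFun⟩

theorem toFun_injective : Function.Injective (toFun : FockSobolev p m → ℂ → ℂ) :=
  Subtype.val_injective

theorem toFun_add (f g : FockSobolev p m) : (f + g).toFun = f.toFun + g.toFun := rfl

theorem toFun_smul (a : ℂ) (f : FockSobolev p m) : (a • f).toFun = a • f.toFun := rfl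

theorem toFun_zero : (0 : FockSobolev p m).toFun = 0 := rfl

theorem differentiable (f : FockSobolev p m) : Differentiable ℂ f := f.2.1

theorem memLp (f : FockSobolev p m) : MemLp (fockWeighted m f) p volume := f.2.2

/-- For `p < ∞` the norm is `(c(p,m) ∫ |z ^ m * f z * exp (-|z|² / 2)| ^ p dA) ^ (1 / p)`, for
`p = ∞` it is the supremum of `|z ^ m * f z * exp (-|z|² / 2)|` (the essential supremum of a
continuous function). -/
instance : Norm (FockSobolev p m) :=
  ⟨fun f => fockConst p m * (eLpNorm (fockWeighted m f) p volume).toReal⟩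

theorem norm_def (f : FockSobolev p m) :
    ‖f‖ = fockConst p m * (eLpNorm (fockWeighted m f) p volume).toReal := rfl

theorem toFun_eq_zero_of_ae (f : FockSobolev p m)
    (h : fockWeighted m f =ᵐ[volume] 0) : f.toFun = 0 := by
  have hc : Continuous f.toFun := f.differentiable.continuous
  have h0 : ∀ᵐ z : ℂ ∂volume, z ≠ 0 := by simp [ae_iff]
  refine (Continuous.ae_eq_iff_eq volume hc continuous_zero).1 ?_
  filter_upwards [h, h0] with z hz hz0
  simpa [fockWeighted, hz0, Complex.exp_ne_zero] using hz

theorem core [hp : Fact (1 ≤ p)] : NormedSpace.Core ℂ (FockSobolev p m) where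
  norm_nonneg f := mul_nonneg (fockConst_pos p m hp.out).le ENNReal.toReal_nonneg
  norm_smul a f := by
    rw [norm_def, norm_def, toFun_smul, fockWeighted_smul, eLpNorm_const_smul,
      ENNReal.toReal_mul, toReal_enorm]
    ring
  norm_triangle f g := by
    rw [norm_def, norm_def, norm_def, toFun_add, fockWeighted_add, ← mul_add,
      ← ENNReal.toReal_add f.memLp.eLpNorm_ne_top g.memLp.eLpNorm_ne_top]
    refine mul_le_mul_of_nonneg_left ?_ (fockConst_pos p m hp.out).le
    exact ENNReal.toReal_mono
      (ENNReal.add_ne_top.2 ⟨f.memLp.eLpNorm_ne_top, g.memLp.eLpNorm_ne_top⟩)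
      (eLpNorm_add_le f.memLp.1 g.memLp.1 hp.out)
  norm_eq_zero_iff f := by
    have hp0 : p ≠ 0 := (one_pos.trans_le hp.out).ne'
    constructor
    · intro h
      rw [norm_def, mul_eq_zero, ENNReal.toReal_eq_zero_iff] at h
      have h1 : eLpNorm (fockWeighted m f) p volume = 0 :=
        (h.resolve_left (fockConst_pos p m hp.out).ne').resolve_right f.memLp.eLpNorm_ne_top
      rw [eLpNorm_eq_zero_iff f.memLp.1 hp0] at h1
      exact toFun_injective (f.toFun_eq_zero_of_ae h1)
    · rintro rfl
      rw [norm_def, toFun_zero, fockWeighted_zero]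
      simp

instance [Fact (1 ≤ p)] : NormedAddCommGroup (FockSobolev p m) :=
  NormedAddCommGroup.ofCore core

instance [Fact (1 ≤ p)] : NormedSpace ℂ (FockSobolev p m) :=
  NormedSpace.ofCore core

end FockSobolev

end

/-! Everything rests on the integral operator `fockProj` with kernel `exp (z * conj w)`, taken
against the square root of the Gaussian weight. After a translation, the mean value property for the
Gaussian measure shows that it reproduces entire functions up to a factor `π`
(`GaussTame.fockProj_mul_sqrtGaussian`). Completing a square dominates its weighted kernel by `exp
(-|z - w|² / 2)`, so Schur's test bounds it on every `L^p`, `1 ≤ p ≤ ∞` (`eLpNorm_fockProj_le`).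

Derivatives: differentiating the reproducing formula `m` times puts `conj w ^ m` on `f`, which has
the modulus of the weight `z ^ m`; this gives `f^(m) ∈ F^p`. Conversely, `f` minus its Taylor
polynomial is an integral of `f^(m)` along the segment from `0` to `z`. Inserting the reproducing
formula for `f^(m)` yields a positive kernel, and `exists_lintegral_remainderKernel_le` verifies
Schur's condition for it: the factor `(1 - t) ^ (m - 1)` of the remainder, integrated against `exp
(-(1 - t)|z|² / 2)`, compensates `|z| ^ (2m)`.

Duality: the pairing is the `L²` pairing of `z ^ m f exp (-|z|² / 2)` with the same expression in
`g`, so Hölder's inequality gives boundedness. For surjectivity no extension of the functional `L`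
is needed. Monomials are orthogonal and `z ^ n` pairs with itself to `π (n + m)!`, which forces the
Taylor coefficients of the representing `g`. For a bounded test function `φ` of bounded support, the
Taylor series of the function `ofLp m φ` in `F^{p,m}` converges in norm, and summation gives `∫ φ *
conj (z ^ m g exp (-|z|² / 2)) = π⁻¹ L (ofLp m φ)` (`FockSobolev.integral_mul_conj_reprFun`). As
`ofLp` is bounded from `L^p`, the converse of Hölder's inequality puts `g` in `F^{q,m}` with norm at
most a constant times `‖L‖`. Density of compactly supported functions in `L^p`, `p < ∞`, then
identifies the pairing with `L`. -/

noncomputable section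

/-! ### Integrability of the Gaussian weight -/

/-- The square root `exp (-|z|² / 2)` of the Gaussian weight. -/
def sqrtGaussian (z : ℂ) : ℝ := Real.exp (-‖z‖ ^ 2 / 2)

theorem sqrtGaussian_pos (z : ℂ) : 0 < sqrtGaussian z := Real.exp_pos _

theorem sqrtGaussian_mul_self (z : ℂ) : sqrtGaussian z * sqrtGaussian z = Real.exp (-‖z‖ ^ 2) := by
  rw [sqrtGaussian, ← Real.exp_add]
  ring_nf

@[fun_prop]
theorem continuous_sqrtGaussian : Continuous sqrtGaussian := by
  unfold sqrtGaussian
  fun_prop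

theorem fockWeighted_eq (m : ℕ) (f : ℂ → ℂ) (z : ℂ) :
    fockWeighted m f z = z ^ m * f z * sqrtGaussian z := rfl

theorem continuous_fockWeighted (m : ℕ) {f : ℂ → ℂ} (hf : Continuous f) :
    Continuous (fockWeighted m f) := by
  unfold fockWeighted
  fun_prop

theorem integrable_exp_neg_mul_norm_sq {b : ℝ} (hb : 0 < b) :
    Integrable (fun z : ℂ => Real.exp (-b * ‖z‖ ^ 2)) := by
  have h := (GaussianFourier.integrable_cexp_neg_mul_sq_norm_add (V := ℂ) (b := (b : ℂ))
    (by simpa using hb) 0 0).norm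
  refine h.congr (Filter.Eventually.of_forall fun z => ?_)
  simp [Complex.norm_exp, ← Complex.ofReal_pow]

theorem memLp_exp_neg_mul_norm_sq {b : ℝ} (hb : 0 < b) (q : ℝ≥0∞) :
    MemLp (fun z : ℂ => Real.exp (-b * ‖z‖ ^ 2)) q volume := by
  have hc : Continuous (fun z : ℂ => Real.exp (-b * ‖z‖ ^ 2)) := by fun_prop
  rcases eq_or_ne q 0 with rfl | h0
  · exact memLp_zero_iff_aestronglyMeasurable.2 hc.aestronglyMeasurable
  rcases eq_or_ne q ∞ with rfl | hq
  · refine memLp_top_of_bound hc.aestronglyMeasurable 1 (Filter.Eventually.of_forall fun z => ?_)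
    rw [Real.norm_eq_abs, abs_of_pos (Real.exp_pos _)]
    exact Real.exp_le_one_iff.2 (by nlinarith [sq_nonneg ‖z‖])
  · rw [← integrable_norm_rpow_iff hc.aestronglyMeasurable h0 hq]
    have hq0 := ENNReal.toReal_pos h0 hq
    refine (integrable_exp_neg_mul_norm_sq (mul_pos hb hq0)).congr
      (Filter.Eventually.of_forall fun z => ?_)
    simp only [Real.norm_eq_abs, abs_of_pos (Real.exp_pos _), ← Real.exp_mul]
    ring_nf

theorem exp_mul_norm_mul_sqrtGaussian_le (R : ℝ) (z : ℂ) :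
    Real.exp (R * ‖z‖) * sqrtGaussian z ≤ Real.exp (R ^ 2) * Real.exp (-(1 / 4) * ‖z‖ ^ 2) := by
  rw [sqrtGaussian, ← Real.exp_add, ← Real.exp_add, Real.exp_le_exp]
  nlinarith [sq_nonneg (R - ‖z‖ / 2)]

theorem memLp_exp_mul_norm_mul_sqrtGaussian (R : ℝ) (q : ℝ≥0∞) :
    MemLp (fun z : ℂ => Real.exp (R * ‖z‖) * sqrtGaussian z) q volume := by
  refine ((memLp_exp_neg_mul_norm_sq (b := 1 / 4) (by norm_num) q).const_mul
    (Real.exp (R ^ 2))).of_le (by fun_prop) (Filter.Eventually.of_forall fun z => ?_)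
  rw [Real.norm_of_nonneg (mul_pos (Real.exp_pos _) (sqrtGaussian_pos z)).le]
  exact (exp_mul_norm_mul_sqrtGaussian_le R z).trans (le_abs_self _)

/-! ### The integral operator with kernel `exp (z * conj w)` and its derivatives -/

/-- `φ` is integrable against `exp (R |z| - |z|² / 2)` for all `R`. -/
def GaussTame (φ : ℂ → ℂ) : Prop :=
  AEStronglyMeasurable φ volume ∧
    ∀ R : ℝ, Integrable (fun w : ℂ => ‖φ w‖ * (Real.exp (R * ‖w‖) * sqrtGaussian w))

theorem MeasureTheory.MemLp.gaussTame {p : ℝ≥0∞} (hp : 1 ≤ p) {φ : ℂ → ℂ}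
    (hφ : MemLp φ p volume) : GaussTame φ := by
  refine ⟨hφ.1, fun R => ?_⟩
  have := Fact.mk hp
  have h : ENNReal.HolderTriple p (ENNReal.conjExponent p) 1 :=
    (ENNReal.HolderConjugate.conjExponent hp)
  exact memLp_one_iff_integrable.1
    (MemLp.mul' (memLp_exp_mul_norm_mul_sqrtGaussian R (ENNReal.conjExponent p)) hφ.norm)

theorem GaussTame.const_mul {φ : ℂ → ℂ} (hφ : GaussTame φ) (c : ℂ) :
    GaussTame (fun w => c * φ w) := by
  refine ⟨hφ.1.const_mul c, fun R => ((hφ.2 R).const_mul ‖c‖).congr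
    (Filter.Eventually.of_forall fun w => ?_)⟩
  simp only [norm_mul]
  ring

/-- The factor `‖w‖` is absorbed by `exp ‖w‖`, at the price of replacing `R` by `R + 1`. Tameness
asks for every `R` so that it survives this, and hence repeated differentiation of `fockProj`. -/
theorem GaussTame.conj_mul {φ : ℂ → ℂ} (hφ : GaussTame φ) :
    GaussTame (fun w => conj w * φ w) := by
  have hm : AEStronglyMeasurable (fun w : ℂ => conj w * φ w) volume :=
    (Complex.continuous_conj.aestronglyMeasurable).mul hφ.1
  refine ⟨hm, fun R => (hφ.2 (R + 1)).mono' (hm.norm.mul (by fun_prop))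
    (Filter.Eventually.of_forall fun w => ?_)⟩
  have := sqrtGaussian_pos w
  rw [Real.norm_of_nonneg (by positivity), add_mul, Real.exp_add, one_mul, norm_mul,
    RCLike.norm_conj]
  have h : ‖w‖ ≤ Real.exp ‖w‖ := (by linarith [Real.add_one_le_exp ‖w‖])
  calc ‖w‖ * ‖φ w‖ * (Real.exp (R * ‖w‖) * sqrtGaussian w)
      ≤ Real.exp ‖w‖ * ‖φ w‖ * (Real.exp (R * ‖w‖) * sqrtGaussian w) := by gcongr
    _ = _ := by ring

theorem GaussTame.conj_pow_mul {φ : ℂ → ℂ} (hφ : GaussTame φ) (n : ℕ) :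
    GaussTame (fun w => conj w ^ n * φ w) := by
  induction n with
  | zero => simpa using hφ
  | succ n ih => simpa only [pow_succ', mul_assoc] using ih.conj_mul

/-- The integral operator with kernel `exp (z * conj w)`. -/
def fockProj (φ : ℂ → ℂ) (z : ℂ) : ℂ :=
  ∫ w, φ w * (Complex.exp (z * conj w) * sqrtGaussian w)

theorem norm_cexp_mul_conj_le (z w : ℂ) : ‖Complex.exp (z * conj w)‖ ≤ Real.exp (‖z‖ * ‖w‖) := by
  rw [Complex.norm_exp, Real.exp_le_exp]
  refine (Complex.re_le_norm _).trans ?_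
  rw [norm_mul, RCLike.norm_conj]

theorem GaussTame.integrable_fockProj {φ : ℂ → ℂ} (hφ : GaussTame φ) (z : ℂ) :
    Integrable (fun w => φ w * (Complex.exp (z * conj w) * sqrtGaussian w)) := by
  refine (hφ.2 ‖z‖).mono' (hφ.1.mul (by fun_prop)) (Filter.Eventually.of_forall fun w => ?_)
  rw [norm_mul, norm_mul, Complex.norm_real, Real.norm_of_nonneg (sqrtGaussian_pos w).le]
  have := sqrtGaussian_pos w
  gcongr
  exact norm_cexp_mul_conj_le z w

theorem GaussTame.hasDerivAt_fockProj {φ : ℂ → ℂ} (hφ : GaussTame φ) (z : ℂ) :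
    HasDerivAt (fockProj φ) (fockProj (fun w => conj w * φ w) z) z := by
  refine (hasDerivAt_integral_of_dominated_loc_of_deriv_le
    (F := fun z w => φ w * (Complex.exp (z * conj w) * sqrtGaussian w))
    (F' := fun z w => conj w * φ w * (Complex.exp (z * conj w) * sqrtGaussian w))
    (bound := fun w => ‖conj w * φ w‖ * (Real.exp ((‖z‖ + 1) * ‖w‖) * sqrtGaussian w))
    (Metric.ball_mem_nhds z one_pos) ?_ (hφ.integrable_fockProj z)
    (hφ.conj_mul.integrable_fockProj z).1 ?_ (hφ.conj_mul.2 _) ?_).2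
  · exact Filter.Eventually.of_forall fun x => (hφ.integrable_fockProj x).1
  · refine Filter.Eventually.of_forall fun w x hx => ?_
    rw [norm_mul _ (_ * _), norm_mul (Complex.exp _), Complex.norm_real,
      Real.norm_of_nonneg (sqrtGaussian_pos w).le]
    have := sqrtGaussian_pos w
    gcongr
    refine (norm_cexp_mul_conj_le x w).trans (Real.exp_le_exp.2 ?_)
    have : ‖x‖ ≤ ‖z‖ + 1 := by
      have h1 := norm_le_norm_add_norm_sub' x z
      have h2 : ‖x - z‖ < 1 := by simpa [dist_eq_norm] using hx
      linarith
    gcongr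
  · refine Filter.Eventually.of_forall fun w x _ => ?_
    have h1 : HasDerivAt (fun x : ℂ => x * conj w) (conj w) x := by
      simpa using (hasDerivAt_id x).mul_const (conj w)
    convert! ((h1.cexp).mul_const (sqrtGaussian w : ℂ)).const_mul (φ w) using 1
    ring

theorem GaussTame.differentiable_fockProj {φ : ℂ → ℂ} (hφ : GaussTame φ) :
    Differentiable ℂ (fockProj φ) := fun z => (hφ.hasDerivAt_fockProj z).differentiableAt

theorem GaussTame.iteratedDeriv_fockProj {φ : ℂ → ℂ} (hφ : GaussTame φ) (n : ℕ) :
    iteratedDeriv n (fockProj φ) = fockProj (fun w => conj w ^ n * φ w) := by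
  induction n with
  | zero => simp
  | succ n ih =>
    rw [iteratedDeriv_succ, ih]
    funext z
    rw [((hφ.conj_pow_mul n).hasDerivAt_fockProj z).deriv]
    simp only [pow_succ', mul_assoc]

theorem fockProj_const_mul (c : ℂ) (φ : ℂ → ℂ) (z : ℂ) :
    fockProj (fun w => c * φ w) z = c * fockProj φ z := by
  unfold fockProj
  simp only [mul_assoc]
  exact integral_const_mul _ _

/-! ### The Gaussian mean value property and the reproducing formula -/

/-- Mean value property with respect to the Gaussian measure. -/
theorem integral_mul_exp_neg_norm_sq {H : ℂ → ℂ} (hH : Differentiable ℂ H)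
    (hi : Integrable (fun w => H w * (Real.exp (-‖w‖ ^ 2) : ℂ))) :
    ∫ w, H w * (Real.exp (-‖w‖ ^ 2) : ℂ) = Real.pi * H 0 := by
  -- The angular integral is constant in `r` by the mean value property on circles; in polar
  -- coordinates only the radial integral of `r * exp (-r²)`, equal to `1 / 2`, remains.
  have hcirc : ∀ r : ℝ, ∫ θ in Set.Ioo (-Real.pi) Real.pi, H (circleMap 0 r θ) =
      2 * Real.pi * H 0 := by
    intro r
    have h := (hH.diffContOnCl (s := Metric.ball 0 |r|)).circleAverage
    rw [Real.circleAverage_eq_integral_add (-Real.pi),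
      intervalIntegral.integral_comp_add_right (fun θ => H (circleMap 0 r θ)),
      show 0 + -Real.pi = -Real.pi by ring, show 2 * Real.pi + -Real.pi = Real.pi by ring,
      intervalIntegral.integral_of_le (by linarith [Real.pi_pos]),
      integral_Ioc_eq_integral_Ioo] at h
    rw [← h, ← Complex.coe_smul, smul_eq_mul]
    push_cast
    rw [mul_inv_cancel_left₀]
    exact_mod_cast (by positivity : 2 * Real.pi ≠ 0)
  have hpt : ∀ x : ℝ × ℝ, Complex.polarCoord.symm x = circleMap 0 x.1 x.2 := by
    intro x
    rw [Complex.polarCoord_symm_apply, circleMap_zero, Complex.exp_mul_I]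
    push_cast
    rfl
  have hint : Integrable (fun x : ℝ × ℝ => x.1 • (H (circleMap 0 x.1 x.2) *
      (Real.exp (-‖circleMap 0 x.1 x.2‖ ^ 2) : ℂ)))
      ((volume.restrict (Set.Ioi 0)).prod (volume.restrict (Set.Ioo (-Real.pi) Real.pi))) := by
    rw [Measure.prod_restrict]
    have hc : Continuous fun x : ℝ × ℝ => circleMap 0 x.1 x.2 := by
      unfold circleMap
      fun_prop
    refine ⟨?_, ?_⟩
    · have := hH.continuous
      exact Continuous.aestronglyMeasurable (by fun_prop)
    · have h1 := hi.2
      rw [hasFiniteIntegral_iff_enorm, ← Complex.lintegral_comp_polarCoord_symm] at h1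
      rw [hasFiniteIntegral_iff_enorm]
      refine lt_of_eq_of_lt (setLIntegral_congr_fun
        (measurableSet_Ioi.prod measurableSet_Ioo) fun x hx => ?_) h1
      simp only [hpt]
      rw [enorm_smul, Real.enorm_of_nonneg (le_of_lt hx.1), smul_eq_mul]
  have hrad : ∫ r in Set.Ioi (0 : ℝ), (r * Complex.exp (-1 * r ^ 2) : ℂ) = 2⁻¹ := by
    rw [integral_mul_cexp_neg_mul_sq (by simp)]
    norm_num
  rw [← Complex.integral_comp_polarCoord_symm, polarCoord_target]
  simp only [hpt]
  rw [Measure.volume_eq_prod, ← Measure.prod_restrict, integral_prod _ hint]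
  calc _ = ∫ r in Set.Ioi (0 : ℝ), (r * Complex.exp (-1 * r ^ 2) : ℂ) * (2 * Real.pi * H 0) := by
        refine setIntegral_congr_fun measurableSet_Ioi fun r hr => ?_
        simp only [norm_circleMap_zero, sq_abs, ← hcirc r, ← integral_const_mul]
        refine integral_congr_ae (Filter.Eventually.of_forall fun θ => ?_)
        simp only [Complex.real_smul]
        push_cast
        ring_nf
    _ = _ := by
        rw [integral_mul_const, hrad]
        ring

/-- With `w = z + v` the exponent `z * conj w - |w|²` becomes `-conj z * v - |v|²`. The integrand is
then an entire function of `v`, with value `h z` at `v = 0`, times the Gaussian weight. -/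
theorem GaussTame.fockProj_mul_sqrtGaussian {h : ℂ → ℂ} (hd : Differentiable ℂ h)
    (ht : GaussTame (fun w => h w * sqrtGaussian w)) (z : ℂ) :
    fockProj (fun w => h w * sqrtGaussian w) z = Real.pi * h z := by
  have e : ∀ w, h w * sqrtGaussian w * (Complex.exp (z * conj w) * sqrtGaussian w) =
      (fun v => h (z + v) * Complex.exp (-(conj z * v)) * (Real.exp (-‖v‖ ^ 2) : ℂ)) (w - z) := by
    intro w
    have h1 : ((sqrtGaussian w : ℝ) : ℂ) * sqrtGaussian w = Complex.exp (-(w * conj w)) := by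
      rw [← Complex.ofReal_mul, sqrtGaussian_mul_self, Complex.mul_conj, Complex.normSq_eq_norm_sq]
      push_cast
      rfl
    have h2 : (Real.exp (-‖w - z‖ ^ 2) : ℂ) = Complex.exp (-((w - z) * conj (w - z))) := by
      rw [Complex.mul_conj, Complex.normSq_eq_norm_sq]
      push_cast
      rfl
    simp only [add_sub_cancel, h2]
    calc _ = h w * (Complex.exp (z * conj w) * (sqrtGaussian w * sqrtGaussian w)) := by ring
      _ = _ := by
        rw [h1, mul_assoc, ← Complex.exp_add, ← Complex.exp_add, map_sub]
        ring_nf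
  have hi := ht.integrable_fockProj z
  simp only [e] at hi
  unfold fockProj
  simp only [e]
  rw [integral_sub_right_eq_self
    (fun v => h (z + v) * Complex.exp (-(conj z * v)) * (Real.exp (-‖v‖ ^ 2) : ℂ)),
    integral_mul_exp_neg_norm_sq (by fun_prop)]
  · simp
  · simpa using hi.comp_add_right z

/-! ### Schur's test and boundedness on `L^p` -/

/-- Schur's test. -/
theorem eLpNorm_lintegral_mul_le {α : Type*} [MeasurableSpace α] {μ : Measure α} [SFinite μ]
    {K : α → α → ℝ≥0∞} (hK : Measurable (Function.uncurry K)) {C : ℝ≥0∞}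
    (hrow : ∀ x, ∫⁻ y, K x y ∂μ ≤ C) (hcol : ∀ y, ∫⁻ x, K x y ∂μ ≤ C)
    {p : ℝ≥0∞} (hp : 1 ≤ p) {u : α → ℝ≥0∞} (hu : AEMeasurable u μ) :
    eLpNorm (fun x => ∫⁻ y, K x y * u y ∂μ) p μ ≤ C * eLpNorm u p μ := by
  have hKx : ∀ x, Measurable (K x) := fun x => hK.comp measurable_prodMk_left
  have hKy : ∀ y, Measurable (fun x => K x y) := fun y => hK.comp measurable_prodMk_right
  rcases eq_or_ne p ∞ with rfl | hp'
  · rw [eLpNorm_exponent_top, eLpNorm_exponent_top]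
    refine essSup_le_of_ae_le _ (Filter.Eventually.of_forall fun x => ?_)
    calc ‖∫⁻ y, K x y * u y ∂μ‖ₑ = ∫⁻ y, K x y * u y ∂μ := enorm_eq_self _
      _ ≤ ∫⁻ y, K x y * eLpNormEssSup u μ ∂μ := by
          refine lintegral_mono_ae ?_
          filter_upwards [ae_le_eLpNormEssSup (f := u) (μ := μ)] with y hy
          exact mul_le_mul_right (by simpa using hy) _
      _ = (∫⁻ y, K x y ∂μ) * eLpNormEssSup u μ := lintegral_mul_const _ (hKx x)
      _ ≤ C * eLpNormEssSup u μ := by gcongr; exact hrow x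
  · have hp0 : p ≠ 0 := (one_pos.trans_le hp).ne'
    set r := p.toReal with hr
    have hr1 : 1 ≤ r := by
      rw [hr, ← ENNReal.toReal_one]
      exact ENNReal.toReal_mono hp' hp
    have hr0 : 0 < r := one_pos.trans_le hr1
    have hpt : ∀ x, (∫⁻ y, K x y * u y ∂μ) ^ r ≤ C ^ (r - 1) * ∫⁻ y, K x y * u y ^ r ∂μ := by
      intro x
      -- Hölder's inequality for the splitting `K u = K ^ (1 - 1/r) * (K u ^ r) ^ (1/r)`. The row
      -- bound takes care of the first factor; the column bound enters later, after Tonelli.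
      have h := ENNReal.lintegral_mul_norm_pow_le (μ := μ) (f := K x)
        (g := fun y => K x y * u y ^ r) (hKx x).aemeasurable
        ((hKx x).aemeasurable.mul (hu.pow_const r)) (p := 1 - 1 / r) (q := 1 / r)
        (by rw [sub_nonneg, div_le_one hr0]; exact hr1) (by positivity) (by ring)
      have e : ∀ y, K x y ^ (1 - 1 / r) * (K x y * u y ^ r) ^ (1 / r) = K x y * u y := by
        intro y
        rw [ENNReal.mul_rpow_of_nonneg _ _ (by positivity), ← ENNReal.rpow_mul,
          mul_one_div_cancel hr0.ne', ENNReal.rpow_one, ← mul_assoc, ← ENNReal.rpow_add_of_nonneg,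
          sub_add_cancel, ENNReal.rpow_one]
        · rw [sub_nonneg, div_le_one hr0]; exact hr1
        · positivity
      simp only [e] at h
      calc (∫⁻ y, K x y * u y ∂μ) ^ r
          ≤ ((∫⁻ y, K x y ∂μ) ^ (1 - 1 / r) * (∫⁻ y, K x y * u y ^ r ∂μ) ^ (1 / r)) ^ r := by
            gcongr
        _ = (∫⁻ y, K x y ∂μ) ^ (r - 1) * ∫⁻ y, K x y * u y ^ r ∂μ := by
            rw [ENNReal.mul_rpow_of_nonneg _ _ hr0.le, ← ENNReal.rpow_mul, ← ENNReal.rpow_mul,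
              one_div_mul_cancel hr0.ne', ENNReal.rpow_one, sub_mul, one_div_mul_cancel hr0.ne',
              one_mul]
        _ ≤ _ := by
            gcongr
            exact hrow x
    rw [eLpNorm_eq_lintegral_rpow_enorm_toReal hp0 hp',
      eLpNorm_eq_lintegral_rpow_enorm_toReal hp0 hp',
      ← hr]
    simp only [enorm_eq_self]
    have hswap : ∫⁻ x, ∫⁻ y, K x y * u y ^ r ∂μ ∂μ ≤ C * ∫⁻ y, u y ^ r ∂μ := by
      rw [lintegral_lintegral_swap]
      · rw [← lintegral_const_mul'' _ (hu.pow_const r)]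
        refine lintegral_mono fun y => ?_
        rw [lintegral_mul_const _ (hKy y)]
        gcongr
        exact hcol y
      · exact hK.aemeasurable.mul ((hu.pow_const r).comp_snd)
    have hmeas : Measurable fun x => ∫⁻ y, K x y * u y ^ r ∂μ := by
      -- A measurable version of `u` gives the same inner integral for every `x`, not only almost
      -- every `x`.
      obtain ⟨v, hv, huv⟩ := hu
      have : (fun x => ∫⁻ y, K x y * u y ^ r ∂μ) = fun x => ∫⁻ y, K x y * v y ^ r ∂μ := by
        funext x
        refine lintegral_congr_ae ?_
        filter_upwards [huv] with y hy
        rw [hy]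
      rw [this]
      exact Measurable.lintegral_prod_right'
        (f := fun z : α × α => K z.1 z.2 * v z.2 ^ r)
        (hK.mul ((hv.comp measurable_snd).pow_const r))
    calc (∫⁻ x, (∫⁻ y, K x y * u y ∂μ) ^ r ∂μ) ^ (1 / r)
        ≤ (∫⁻ x, C ^ (r - 1) * ∫⁻ y, K x y * u y ^ r ∂μ ∂μ) ^ (1 / r) := by
          gcongr with x
          exact hpt x
      _ ≤ (C ^ (r - 1) * (C * ∫⁻ y, u y ^ r ∂μ)) ^ (1 / r) := by
          rw [lintegral_const_mul _ hmeas]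
          gcongr
      _ = C * (∫⁻ y, u y ^ r ∂μ) ^ (1 / r) := by
          rw [← mul_assoc, ENNReal.mul_rpow_of_nonneg _ _ (by positivity)]
          congr 1
          nth_rewrite 2 [← ENNReal.rpow_one C]
          rw [← ENNReal.rpow_add_of_nonneg _ _ (by linarith) zero_le_one, sub_add_cancel,
            ← ENNReal.rpow_mul, mul_one_div_cancel hr0.ne', ENNReal.rpow_one]

/-- Completing the square in `w`. The case `t = 1` bounds `fockProj`; the values `t ∈ (0, 1]` serve
the Taylor remainder. -/
theorem norm_cexp_mul_conj_mul_sqrtGaussian (t : ℝ) (z w : ℂ) :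
    ‖Complex.exp (t * z * conj w)‖ * sqrtGaussian w =
      Real.exp (t ^ 2 * ‖z‖ ^ 2 / 2) * sqrtGaussian (t * z - w) := by
  rw [Complex.norm_exp, sqrtGaussian, sqrtGaussian, ← Real.exp_add, ← Real.exp_add]
  congr 1
  simp only [← Complex.normSq_eq_norm_sq, Complex.normSq_apply, Complex.mul_re, Complex.mul_im,
    Complex.conj_re, Complex.conj_im, Complex.sub_re, Complex.sub_im, Complex.ofReal_re,
    Complex.ofReal_im]
  ring

/-- The total mass of `sqrtGaussian`. -/
def sqrtGaussianMass : ℝ≥0∞ := ∫⁻ w : ℂ, ‖sqrtGaussian w‖ₑ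

theorem integrable_norm_pow_mul_sqrtGaussian (n : ℕ) :
    Integrable (fun w : ℂ => ‖w‖ ^ n * sqrtGaussian w) := by
  have h := memLp_one_iff_integrable.1 (memLp_exp_mul_norm_mul_sqrtGaussian 1 1)
  refine (h.const_mul (n.factorial : ℝ)).mono' (by fun_prop)
    (Filter.Eventually.of_forall fun w => ?_)
  have := sqrtGaussian_pos w
  rw [Real.norm_of_nonneg (by positivity), ← mul_assoc, one_mul]
  gcongr
  have h2 := Real.pow_div_factorial_le_exp ‖w‖ (norm_nonneg w) n
  rwa [div_le_iff₀' (by positivity)] at h2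

theorem sqrtGaussianMass_ne_top : sqrtGaussianMass ≠ ∞ := by
  have h := (integrable_norm_pow_mul_sqrtGaussian 0).2
  simp only [pow_zero, one_mul] at h
  exact h.ne

theorem enorm_fockProj_mul_le (φ : ℂ → ℂ) (z : ℂ) :
    ‖fockProj φ z * sqrtGaussian z‖ₑ ≤ ∫⁻ w, ‖sqrtGaussian (z - w)‖ₑ * ‖φ w‖ₑ := by
  unfold fockProj
  rw [← integral_mul_const]
  refine (enorm_integral_le_lintegral_enorm _).trans (le_of_eq (lintegral_congr fun w => ?_))
  rw [← ofReal_norm, ← ofReal_norm, ← ofReal_norm, ← ENNReal.ofReal_mul (norm_nonneg _)]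
  congr 1
  have h := norm_cexp_mul_conj_mul_sqrtGaussian 1 z w
  simp only [Complex.ofReal_one, one_mul, one_pow] at h
  have e : Real.exp (‖z‖ ^ 2 / 2) * sqrtGaussian z = 1 := by
    rw [sqrtGaussian, ← Real.exp_add, ← Real.exp_zero]
    ring_nf
  simp only [norm_mul, Complex.norm_real, Real.norm_of_nonneg (sqrtGaussian_pos _).le]
  calc _ = ‖φ w‖ * (‖Complex.exp (z * conj w)‖ * sqrtGaussian w) * sqrtGaussian z := by ring
    _ = ‖φ w‖ * sqrtGaussian (z - w) * (Real.exp (‖z‖ ^ 2 / 2) * sqrtGaussian z) := by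
        rw [h]; ring
    _ = _ := by rw [e]; ring

/-- The weighted operator is dominated by convolution with `sqrtGaussian`, whose row and column
integrals equal its total mass by translation invariance. -/
theorem eLpNorm_fockProj_le {p : ℝ≥0∞} (hp : 1 ≤ p) {φ : ℂ → ℂ}
    (hφ : AEStronglyMeasurable φ volume) :
    eLpNorm (fun z => fockProj φ z * sqrtGaussian z) p volume ≤
      sqrtGaussianMass * eLpNorm φ p volume := by
  have hs := eLpNorm_lintegral_mul_le (μ := (volume : Measure ℂ))
    (K := fun z w => ‖sqrtGaussian (z - w)‖ₑ) (C := sqrtGaussianMass)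
    (Continuous.measurable (by unfold Function.uncurry; fun_prop)) ?_ ?_ hp hφ.enorm
  · rw [eLpNorm_enorm] at hs
    refine le_trans (eLpNorm_mono_enorm fun z => ?_) hs
    rw [enorm_eq_self]
    exact enorm_fockProj_mul_le φ z
  · intro z
    rw [lintegral_sub_left_eq_self (fun w => ‖sqrtGaussian w‖ₑ) z, sqrtGaussianMass]
  · intro w
    rw [lintegral_sub_right_eq_self (fun w => ‖sqrtGaussian w‖ₑ) w, sqrtGaussianMass]

theorem memLp_fockProj {p : ℝ≥0∞} (hp : 1 ≤ p) {φ : ℂ → ℂ} (hφ : MemLp φ p volume) :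
    MemLp (fun z => fockProj φ z * sqrtGaussian z) p volume := by
  refine ⟨Continuous.aestronglyMeasurable ?_, (eLpNorm_fockProj_le hp hφ.1).trans_lt
    (ENNReal.mul_lt_top sqrtGaussianMass_ne_top.lt_top hφ.2)⟩
  have := (hφ.gaussTame hp).differentiable_fockProj.continuous
  fun_prop

/-! ### From the weighted function to its derivative -/

theorem memLp_pow_mul_sqrtGaussian (n : ℕ) (q : ℝ≥0∞) :
    MemLp (fun z : ℂ => z ^ n * (sqrtGaussian z : ℂ)) q volume := by
  refine ((memLp_exp_mul_norm_mul_sqrtGaussian 1 q).const_mul (n.factorial : ℝ)).of_le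
    (by fun_prop) (Filter.Eventually.of_forall fun z => ?_)
  have := sqrtGaussian_pos z
  rw [Real.norm_of_nonneg (by positivity), norm_mul, norm_pow, Complex.norm_real,
    Real.norm_of_nonneg this.le, ← mul_assoc, one_mul]
  gcongr
  have h2 := Real.pow_div_factorial_le_exp ‖z‖ (norm_nonneg z) n
  rwa [div_le_iff₀' (by positivity)] at h2

theorem memLp_fockWeighted_pow (m n : ℕ) (q : ℝ≥0∞) :
    MemLp (fockWeighted m (fun z => z ^ n)) q volume := by
  convert! memLp_pow_mul_sqrtGaussian (m + n) q using 2 with z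
  rw [fockWeighted_eq, pow_add]

/-- The factor `z ^ m` is small only in the unit disc, where `f` is bounded by continuity; outside
it `|z ^ m| ≥ 1`. -/
theorem memLp_mul_sqrtGaussian_of_fockWeighted {m : ℕ} {p : ℝ≥0∞} {f : ℂ → ℂ} (hf : Continuous f)
    (h : MemLp (fockWeighted m f) p volume) :
    MemLp (fun z => f z * (sqrtGaussian z : ℂ)) p volume := by
  obtain ⟨M, hM⟩ := (isCompact_closedBall (0 : ℂ) 1).exists_bound_of_continuousOn hf.continuousOn
  have hM0 : 0 ≤ M := (norm_nonneg _).trans (hM 0 (by simp))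
  have h2 : MemLp (fun z => ‖fockWeighted m f z‖ + M * ‖z ^ 0 * (sqrtGaussian z : ℂ)‖) p volume :=
    h.norm.add ((memLp_pow_mul_sqrtGaussian 0 p).norm.const_mul M)
  refine h2.of_le (by fun_prop) (Filter.Eventually.of_forall fun z => ?_)
  rw [Real.norm_of_nonneg (by positivity), fockWeighted_eq, pow_zero, one_mul]
  simp only [norm_mul, norm_pow]
  rcases le_total ‖z‖ 1 with hz | hz
  · have := hM z (by simpa using hz)
    have h3 : ‖f z‖ * ‖(sqrtGaussian z : ℂ)‖ ≤ M * ‖(sqrtGaussian z : ℂ)‖ := by gcongr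
    have h4 : 0 ≤ ‖z‖ ^ m * ‖f z‖ * ‖(sqrtGaussian z : ℂ)‖ := by positivity
    linarith
  · have h3 : 1 * (‖f z‖ * ‖(sqrtGaussian z : ℂ)‖) ≤ ‖z‖ ^ m * (‖f z‖ * ‖(sqrtGaussian z : ℂ)‖) := by
      gcongr
      exact one_le_pow₀ hz
    have h4 : 0 ≤ M * ‖(sqrtGaussian z : ℂ)‖ := by positivity
    linarith

theorem eq_fockProj_of_gaussTame {f : ℂ → ℂ} (hf : Differentiable ℂ f)
    (h : GaussTame (fun z => f z * (sqrtGaussian z : ℂ))) :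
    f = fockProj (fun w => (Real.pi : ℂ)⁻¹ * (f w * sqrtGaussian w)) := by
  funext z
  rw [fockProj_const_mul, h.fockProj_mul_sqrtGaussian hf, inv_mul_cancel_left₀]
  exact_mod_cast Real.pi_ne_zero

/-- Differentiating the reproducing formula multiplies the density by `conj w ^ m`, so that its
modulus becomes `π⁻¹ |fockWeighted m f|`, and `fockProj` is bounded on `L^p`. -/
theorem memLp_iteratedDeriv_of_fockWeighted {m : ℕ} {p : ℝ≥0∞} (hp : 1 ≤ p) {f : ℂ → ℂ}
    (hf : Differentiable ℂ f) (h : MemLp (fockWeighted m f) p volume) :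
    MemLp (fun z => iteratedDeriv m f z * (sqrtGaussian z : ℂ)) p volume := by
  have ht := (memLp_mul_sqrtGaussian_of_fockWeighted hf.continuous h).gaussTame hp
  rw [eq_fockProj_of_gaussTame hf ht, (ht.const_mul _).iteratedDeriv_fockProj]
  refine memLp_fockProj hp ((h.norm.const_mul Real.pi⁻¹).of_le
    (((ht.const_mul _).conj_pow_mul m).1) (Filter.Eventually.of_forall fun z => le_of_eq ?_))
  simp only [fockWeighted_eq, norm_mul, norm_pow, norm_inv, RCLike.norm_conj, norm_norm,
    Complex.norm_real]
  ring

/-! ### Taylor remainders: from the derivative to the weighted function -/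

theorem iteratedDeriv_comp_ofReal_mul {f : ℂ → ℂ} (hf : Differentiable ℂ f) (z : ℂ) (k : ℕ) :
    iteratedDeriv k (fun t : ℝ => f (t * z)) = fun t : ℝ => z ^ k * iteratedDeriv k f (t * z) := by
  induction k with
  | zero => simp
  | succ k ih =>
    rw [iteratedDeriv_succ, ih]
    funext t
    have h1 : HasDerivAt (fun t : ℝ => (t : ℂ) * z) z t := by
      simpa using (Complex.ofRealCLM.hasDerivAt (x := t)).mul_const z
    have h2 : HasDerivAt (iteratedDeriv k f) (iteratedDeriv (k + 1) f (t * z)) (t * z) := by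
      rw [iteratedDeriv_succ]
      exact ((hf.contDiff (n := (k + 1 : ℕ))).differentiable_iteratedDeriv k
        (by exact_mod_cast Nat.lt_succ_self k) _).hasDerivAt
    have h3 := (h2.comp_of_eq t h1 rfl).const_mul (z ^ k)
    rw [show (fun t : ℝ => z ^ k * iteratedDeriv k f (t * z)) =
      fun t : ℝ => z ^ k * (iteratedDeriv k f ∘ fun t : ℝ => (t : ℂ) * z) t from rfl, h3.deriv]
    ring

/-- Taylor's formula on the segment from `0` to `z`, with integral remainder. -/
theorem Differentiable.eq_taylor_add_integral {f : ℂ → ℂ} (hf : Differentiable ℂ f) (n : ℕ)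
    (z : ℂ) :
    f z = (∑ k ∈ Finset.range (n + 1), (iteratedDeriv k f 0 / k.factorial) * z ^ k) +
      ∫ t in (0 : ℝ)..1, ((1 - t) ^ n / n.factorial : ℝ) •
        (z ^ (n + 1) * iteratedDeriv (n + 1) f (t * z)) := by
  have hc : ContDiff ℝ (n + 1 : ℕ) (fun t : ℝ => f (t * z)) := by
    have h1 : ContDiff ℝ (n + 1 : ℕ) f := (hf.contDiff (n := (n + 1 : ℕ))).restrict_scalars ℝ
    exact h1.comp ((Complex.ofRealCLM.contDiff).mul contDiff_const)
  have hw : ∀ k ≤ n + 1, ∀ t ∈ Set.uIcc (0 : ℝ) 1,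
      iteratedDerivWithin k (fun t : ℝ => f (t * z)) (Set.uIcc 0 1) t =
        z ^ k * iteratedDeriv k f (t * z) := by
    intro k hk t ht
    rw [iteratedDerivWithin_eq_iteratedDeriv (uniqueDiffOn_uIcc zero_ne_one)
      ((hc.of_le (by exact_mod_cast hk)).contDiffAt) ht, iteratedDeriv_comp_ofReal_mul hf]
  have h := taylor_integral_remainder (f := fun t : ℝ => f (t * z)) (x := 1) (x₀ := 0) (n := n)
    hc.contDiffOn
  rw [taylor_within_apply, sub_eq_iff_eq_add'] at h
  simp only [Complex.ofReal_one, one_mul] at h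
  rw [h]
  congr 1
  · refine Finset.sum_congr rfl fun k hk => ?_
    rw [hw k (Finset.mem_range.1 hk).le 0 (by simp)]
    simp
    ring
  · refine intervalIntegral.integral_congr fun t ht => ?_
    rw [hw (n + 1) le_rfl t ht]

/-- This is a Gamma integral in `s = (1 - t) x`, hence bounded uniformly in `x`. Half of the
exponential beats the power, since `(s/4) ^ n ≤ n! exp (s/4)`; what is left, `x * exp (-(1 - t) x /
4)`, has integral at most `4`. -/
theorem lintegral_pow_mul_exp_le (n : ℕ) {x : ℝ} (hx : 0 ≤ x) :
    ∫⁻ t in Set.Ioc (0 : ℝ) 1,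
      ENNReal.ofReal (x ^ (n + 1) * ((1 - t) ^ n * Real.exp (-((1 - t) * x / 2)))) ≤
      ENNReal.ofReal (n.factorial * 4 ^ (n + 1)) := by
  have hpt : ∀ t ∈ Set.Ioc (0 : ℝ) 1,
      x ^ (n + 1) * ((1 - t) ^ n * Real.exp (-((1 - t) * x / 2))) ≤
        n.factorial * 4 ^ n * (x * Real.exp ((t - 1) * (x / 4))) := by
    intro t ht
    have hs : 0 ≤ (1 - t) * x / 4 := by
      have : 0 ≤ 1 - t := sub_nonneg.2 ht.2
      positivity
    have h := Real.pow_div_factorial_le_exp _ hs n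
    rw [div_le_iff₀ (by positivity)] at h
    have e : Real.exp ((t - 1) * (x / 4)) =
        Real.exp ((1 - t) * x / 4) * Real.exp (-((1 - t) * x / 2)) := by
      rw [← Real.exp_add]; ring_nf
    rw [e]
    calc _ = 4 ^ n * x * ((1 - t) * x / 4) ^ n * Real.exp (-((1 - t) * x / 2)) := by
          rw [div_pow, mul_pow]; field_simp; ring
      _ ≤ 4 ^ n * x * (Real.exp ((1 - t) * x / 4) * n.factorial) *
          Real.exp (-((1 - t) * x / 2)) := by gcongr
      _ = _ := by ring
  have hint : ∫ t in (0 : ℝ)..1, x * Real.exp ((t - 1) * (x / 4)) = 4 - 4 * Real.exp (-(x / 4)) := by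
    rw [intervalIntegral.integral_eq_sub_of_hasDerivAt
      (f := fun t => 4 * Real.exp ((t - 1) * (x / 4)))]
    · simp
    · intro t _
      have h1 : HasDerivAt (fun t : ℝ => (t - 1) * (x / 4)) (x / 4) t := by
        simpa using ((hasDerivAt_id t).sub_const 1).mul_const (x / 4)
      convert! (h1.exp).const_mul 4 using 1
      ring
    · exact Continuous.intervalIntegrable (by fun_prop) _ _
  calc _ ≤ ∫⁻ t in Set.Ioc (0 : ℝ) 1,
        ENNReal.ofReal (n.factorial * 4 ^ n * (x * Real.exp ((t - 1) * (x / 4)))) :=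
        setLIntegral_mono (by fun_prop) fun t ht => ENNReal.ofReal_le_ofReal (hpt t ht)
    _ = ENNReal.ofReal
        (∫ t in (0 : ℝ)..1, n.factorial * 4 ^ n * (x * Real.exp ((t - 1) * (x / 4)))) := by
        rw [intervalIntegral.integral_of_le zero_le_one, ofReal_integral_eq_lintegral_ofReal]
        · exact (Continuous.integrableOn_Ioc (by fun_prop))
        · exact Filter.Eventually.of_forall fun t => by positivity
    _ ≤ _ := by
        rw [intervalIntegral.integral_const_mul, hint]
        refine ENNReal.ofReal_le_ofReal ?_
        rw [pow_succ, ← mul_assoc]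
        gcongr
        linarith [Real.exp_pos (-(x / 4))]

/-- The integrand of `remainderKernel`. -/
def remainderIntegrand (n : ℕ) (z w : ℂ) (t : ℝ) : ℝ :=
  ‖z‖ ^ (2 * (n + 1)) * sqrtGaussian z * |1 - t| ^ n *
    (‖Complex.exp (t * z * conj w)‖ * sqrtGaussian w)

/-- The kernel which controls `z ^ (n + 1)` times the Taylor remainder of order `n + 1` of a
function in terms of its derivative of order `n + 1`. -/
def remainderKernel (n : ℕ) (z w : ℂ) : ℝ≥0∞ :=
  ∫⁻ t in Set.Ioc (0 : ℝ) 1, ENNReal.ofReal (remainderIntegrand n z w t)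

theorem continuous_remainderIntegrand (n : ℕ) :
    Continuous fun x : (ℂ × ℂ) × ℝ => remainderIntegrand n x.1.1 x.1.2 x.2 := by
  unfold remainderIntegrand
  fun_prop

theorem measurable_remainderKernel (n : ℕ) :
    Measurable (Function.uncurry (remainderKernel n)) := by
  refine Measurable.lintegral_prod_right'
    (f := fun x : (ℂ × ℂ) × ℝ => ENNReal.ofReal (remainderIntegrand n x.1.1 x.1.2 x.2)) ?_
  exact (continuous_remainderIntegrand n).measurable.ennreal_ofReal

theorem exp_mul_sqrtGaussian_le {t : ℝ} (ht : t ∈ Set.Ioc (0 : ℝ) 1) (z : ℂ) :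
    Real.exp (t ^ 2 * ‖z‖ ^ 2 / 2) * sqrtGaussian z ≤ Real.exp (-((1 - t) * ‖z‖ ^ 2 / 2)) := by
  rw [sqrtGaussian, ← Real.exp_add, Real.exp_le_exp]
  have : t ^ 2 ≤ t := by nlinarith [ht.1, ht.2]
  nlinarith [mul_le_mul_of_nonneg_right this (sq_nonneg ‖z‖)]

/-- Bound for rows: as a function of `w` this is a Gaussian centred at `t z`, and its coefficient is
the integrand of `lintegral_pow_mul_exp_le` at `x = |z|²`. -/
theorem remainderIntegrand_le_left {n : ℕ} {t : ℝ} (ht : t ∈ Set.Ioc (0 : ℝ) 1) (z w : ℂ) :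
    remainderIntegrand n z w t ≤
      (‖z‖ ^ 2) ^ (n + 1) * ((1 - t) ^ n * Real.exp (-((1 - t) * ‖z‖ ^ 2 / 2))) *
        ‖sqrtGaussian (t * z - w)‖ := by
  rw [remainderIntegrand, norm_cexp_mul_conj_mul_sqrtGaussian, abs_of_nonneg (sub_nonneg.2 ht.2),
    Real.norm_of_nonneg (sqrtGaussian_pos _).le]
  have h1 := sqrtGaussian_pos (t * z - w)
  have h2 : 0 ≤ 1 - t := sub_nonneg.2 ht.2
  calc _ = (‖z‖ ^ 2) ^ (n + 1) * ((1 - t) ^ n *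
        (Real.exp (t ^ 2 * ‖z‖ ^ 2 / 2) * sqrtGaussian z)) * sqrtGaussian (t * z - w) := by
        rw [← pow_mul]; ring
    _ ≤ _ := by gcongr; exact exp_mul_sqrtGaussian_le ht z

/-- Bound for columns: `|exp (t z conj w)|` is symmetric in `z` and `w`, so the square may be
completed in `z` instead. The power of `|z|` is then split by `|z| ≤ |t w - z| + |w|`, so that only
the Gaussian centred at `t w` depends on `z`. -/
theorem remainderIntegrand_le_right {n : ℕ} {t : ℝ} (ht : t ∈ Set.Ioc (0 : ℝ) 1) (z w : ℂ) :
    remainderIntegrand n z w t ≤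
      2 ^ (2 * (n + 1)) * (((1 - t) ^ n * Real.exp (-((1 - t) * ‖w‖ ^ 2 / 2))) *
        (‖t * w - z‖ ^ (2 * (n + 1)) * sqrtGaussian (t * w - z)) +
        ((‖w‖ ^ 2) ^ (n + 1) * ((1 - t) ^ n * Real.exp (-((1 - t) * ‖w‖ ^ 2 / 2)))) *
        (‖t * w - z‖ ^ 0 * sqrtGaussian (t * w - z))) := by
  have h1 := sqrtGaussian_pos (t * w - z)
  have h2 : 0 ≤ 1 - t := sub_nonneg.2 ht.2
  have hsymm : ‖Complex.exp (t * z * conj w)‖ = ‖Complex.exp (t * w * conj z)‖ := by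
    rw [Complex.norm_exp, Complex.norm_exp]
    congr 1
    simp only [Complex.mul_re, Complex.mul_im, Complex.conj_re, Complex.conj_im, Complex.ofReal_re,
      Complex.ofReal_im]
    ring
  have hz : ‖z‖ ^ (2 * (n + 1)) ≤
      2 ^ (2 * (n + 1)) * (‖t * w - z‖ ^ (2 * (n + 1)) + ‖w‖ ^ (2 * (n + 1))) := by
    have h3 : ‖z‖ ≤ ‖t * w - z‖ + ‖w‖ := by
      have h4 : ‖(t : ℂ) * w‖ ≤ ‖w‖ := by
        rw [norm_mul, Complex.norm_real, Real.norm_of_nonneg ht.1.le]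
        exact mul_le_of_le_one_left (norm_nonneg _) ht.2
      have h5 := norm_sub_le ((t : ℂ) * w) (t * w - z)
      rw [sub_sub_cancel] at h5
      linarith
    calc ‖z‖ ^ (2 * (n + 1)) ≤ (‖t * w - z‖ + ‖w‖) ^ (2 * (n + 1)) := by gcongr
      _ ≤ 2 ^ (2 * (n + 1) - 1) * (‖t * w - z‖ ^ (2 * (n + 1)) + ‖w‖ ^ (2 * (n + 1))) :=
          add_pow_le (norm_nonneg _) (norm_nonneg _) _
      _ ≤ _ := by
          gcongr
          · norm_num
          · omega
  have hs := norm_cexp_mul_conj_mul_sqrtGaussian t w z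
  rw [remainderIntegrand, hsymm, abs_of_nonneg h2]
  calc _ = ‖z‖ ^ (2 * (n + 1)) * ((1 - t) ^ n *
        ((‖Complex.exp (t * w * conj z)‖ * sqrtGaussian z) * sqrtGaussian w)) := by ring
    _ = ‖z‖ ^ (2 * (n + 1)) * ((1 - t) ^ n *
        (Real.exp (t ^ 2 * ‖w‖ ^ 2 / 2) * sqrtGaussian w)) * sqrtGaussian (t * w - z) := by
        rw [hs]; ring
    _ ≤ (2 ^ (2 * (n + 1)) * (‖t * w - z‖ ^ (2 * (n + 1)) + ‖w‖ ^ (2 * (n + 1)))) * ((1 - t) ^ n *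
        Real.exp (-((1 - t) * ‖w‖ ^ 2 / 2))) * sqrtGaussian (t * w - z) := by
        have := sqrtGaussian_pos w
        gcongr
        exact exp_mul_sqrtGaussian_le ht w
    _ = _ := by rw [pow_zero, ← pow_mul]; ring

theorem lintegral_norm_pow_mul_sqrtGaussian_lt_top (k : ℕ) :
    ∫⁻ w : ℂ, ENNReal.ofReal (‖w‖ ^ k * sqrtGaussian w) < ∞ :=
  (integrable_norm_pow_mul_sqrtGaussian k).lintegral_lt_top

/-- By Tonelli the plane integral is done first: it gives Gaussian moments independent of the
centre, and the remaining `t` integral is `lintegral_pow_mul_exp_le`. -/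
theorem exists_lintegral_remainderKernel_le (n : ℕ) :
    ∃ C : ℝ≥0∞, C ≠ ∞ ∧ (∀ z, ∫⁻ w, remainderKernel n z w ≤ C) ∧
      ∀ w, ∫⁻ z, remainderKernel n z w ≤ C := by
  set A : ℝ≥0∞ := ENNReal.ofReal (n.factorial * 4 ^ (n + 1)) with hA
  set B : ℕ → ℝ≥0∞ := fun k => ∫⁻ w : ℂ, ENNReal.ofReal (‖w‖ ^ k * sqrtGaussian w) with hB
  have hBt : ∀ k, B k ≠ ∞ := fun k => (lintegral_norm_pow_mul_sqrtGaussian_lt_top k).ne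
  have hcont := continuous_remainderIntegrand n
  have hBsub : ∀ (k : ℕ) (a : ℂ),
      ∫⁻ z, ENNReal.ofReal (‖a - z‖ ^ k * sqrtGaussian (a - z)) = B k := fun k a =>
    lintegral_sub_left_eq_self (fun z => ENNReal.ofReal (‖z‖ ^ k * sqrtGaussian z)) a
  refine ⟨A * B 0 + ENNReal.ofReal (2 ^ (2 * (n + 1))) * (B (2 * (n + 1)) + A * B 0), ?_, ?_, ?_⟩
  · refine ENNReal.add_ne_top.2 ⟨ENNReal.mul_ne_top ENNReal.ofReal_ne_top (hBt 0),
      ENNReal.mul_ne_top ENNReal.ofReal_ne_top (ENNReal.add_ne_top.2 ⟨hBt _,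
        ENNReal.mul_ne_top ENNReal.ofReal_ne_top (hBt 0)⟩)⟩
  · intro z
    refine le_trans ?_ le_self_add
    unfold remainderKernel
    rw [lintegral_lintegral_swap (Continuous.measurable
      (hcont.comp (f := fun x : ℂ × ℝ => ((z, x.1), x.2)) (by fun_prop))).ennreal_ofReal.aemeasurable]
    calc _ ≤ ∫⁻ t in Set.Ioc (0 : ℝ) 1, ENNReal.ofReal
          ((‖z‖ ^ 2) ^ (n + 1) * ((1 - t) ^ n * Real.exp (-((1 - t) * ‖z‖ ^ 2 / 2)))) * B 0 := by
          refine setLIntegral_mono (by fun_prop) fun t ht => ?_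
          have h2 : 0 ≤ 1 - t := sub_nonneg.2 ht.2
          rw [← hBsub 0 (t * z), ← lintegral_const_mul _ (by fun_prop)]
          refine lintegral_mono fun w => ?_
          rw [← ENNReal.ofReal_mul (by positivity)]
          refine ENNReal.ofReal_le_ofReal ((remainderIntegrand_le_left ht z w).trans_eq ?_)
          rw [pow_zero, one_mul, Real.norm_of_nonneg (sqrtGaussian_pos _).le]
      _ ≤ A * B 0 := by
          rw [lintegral_mul_const _ (by fun_prop)]
          gcongr
          exact lintegral_pow_mul_exp_le n (sq_nonneg _)
  · intro w
    refine le_trans ?_ le_add_self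
    unfold remainderKernel
    rw [lintegral_lintegral_swap (Continuous.measurable
      (hcont.comp (f := fun x : ℂ × ℝ => ((x.1, w), x.2)) (by fun_prop))).ennreal_ofReal.aemeasurable]
    calc _ ≤ ∫⁻ t in Set.Ioc (0 : ℝ) 1, ENNReal.ofReal (2 ^ (2 * (n + 1))) *
          (B (2 * (n + 1)) + ENNReal.ofReal
          ((‖w‖ ^ 2) ^ (n + 1) * ((1 - t) ^ n * Real.exp (-((1 - t) * ‖w‖ ^ 2 / 2)))) * B 0) := by
          refine setLIntegral_mono (by fun_prop) fun t ht => ?_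
          have h2 : 0 ≤ 1 - t := sub_nonneg.2 ht.2
          rw [← hBsub 0 (t * w), ← hBsub (2 * (n + 1)) (t * w),
            ← lintegral_const_mul _ (by fun_prop), ← lintegral_add_left (by fun_prop),
            ← lintegral_const_mul _ (by fun_prop)]
          refine lintegral_mono fun z => ?_
          have hg := sqrtGaussian_pos (t * w - z)
          rw [← ENNReal.ofReal_mul (by positivity), ← ENNReal.ofReal_add (by positivity)
            (by positivity), ← ENNReal.ofReal_mul (by positivity)]
          refine ENNReal.ofReal_le_ofReal ((remainderIntegrand_le_right ht z w).trans ?_)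
          -- In the first summand the factor depending on `t` is simply at most `1`; the second
          -- keeps it, to compensate the power of `|w|`.
          refine mul_le_mul_of_nonneg_left (add_le_add (mul_le_of_le_one_left (by positivity)
            (mul_le_one₀ (pow_le_one₀ h2 ?_) (by positivity) (Real.exp_le_one_iff.2 ?_))) le_rfl)
            (by positivity)
          · linarith [ht.1]
          · have : 0 ≤ (1 - t) * ‖w‖ ^ 2 / 2 := by positivity
            linarith
      _ ≤ _ := by
          rw [lintegral_const_mul _ (by fun_prop), lintegral_add_left (by fun_prop),
            lintegral_mul_const _ (by fun_prop)]
          gcongr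
          · simp
          · exact lintegral_pow_mul_exp_le n (sq_nonneg _)

/-- The weighted Taylor polynomial `T` of degree `m - 1` lies in every `L^p`. In the remainder, `z ^
m` from the weight and `z ^ m` from Taylor's formula make up `|z| ^ (2m)`, and the reproducing
formula for the derivative turns it into `remainderKernel` applied to `|ψ|`. -/
theorem memLp_fockWeighted_of_iteratedDeriv {m : ℕ} (hm : 0 < m) {p : ℝ≥0∞} (hp : 1 ≤ p) {f : ℂ → ℂ}
    (hf : Differentiable ℂ f)
    (h : MemLp (fun z => iteratedDeriv m f z * (sqrtGaussian z : ℂ)) p volume) :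
    MemLp (fockWeighted m f) p volume := by
  obtain ⟨n, rfl⟩ : ∃ n, m = n + 1 := ⟨m - 1, by omega⟩
  set D := iteratedDeriv (n + 1) f with hD
  have hDd : Differentiable ℂ D := (hf.contDiff (n := (n + 2 : ℕ))).differentiable_iteratedDeriv
    (n + 1) (by exact_mod_cast Nat.lt_succ_self _)
  set ψ : ℂ → ℂ := fun w => (Real.pi : ℂ)⁻¹ * (D w * sqrtGaussian w) with hψ
  have hψm : MemLp ψ p volume := h.const_mul _
  have hDψ : D = fockProj ψ := eq_fockProj_of_gaussTame hDd (h.gaussTame hp)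
  set T : ℂ → ℂ := fun z => ∑ k ∈ Finset.range (n + 1), (iteratedDeriv k f 0 / k.factorial) *
    fockWeighted (n + 1) (fun z => z ^ k) z with hT
  have hTm : MemLp T p volume :=
    memLp_finsetSum _ fun k _ => (memLp_fockWeighted_pow (n + 1) k p).const_mul _
  have hbound : ∀ z, ‖fockWeighted (n + 1) f z - T z‖ₑ ≤ ∫⁻ w, remainderKernel n z w * ‖ψ w‖ₑ := by
    intro z
    have e : fockWeighted (n + 1) f z - T z = z ^ (n + 1) * sqrtGaussian z *
        ∫ t in (0 : ℝ)..1, ((1 - t) ^ n / n.factorial : ℝ) • (z ^ (n + 1) * D (t * z)) := by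
      have h1 := hf.eq_taylor_add_integral n z
      rw [← sub_eq_iff_eq_add'] at h1
      rw [← h1, hT, fockWeighted_eq, mul_sub, Finset.mul_sum]
      congr 1
      · ring
      · refine Finset.sum_congr rfl fun k _ => ?_
        rw [fockWeighted_eq]
        ring
    have hDb : ∀ t : ℝ, ‖D (t * z)‖ₑ ≤ ∫⁻ w,
        ENNReal.ofReal (‖Complex.exp (t * z * conj w)‖ * sqrtGaussian w) * ‖ψ w‖ₑ := by
      intro t
      rw [hDψ, fockProj]
      refine (enorm_integral_le_lintegral_enorm _).trans_eq (lintegral_congr fun w => ?_)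
      rw [enorm_mul, mul_comm, ← ofReal_norm (_ * _), norm_mul, Complex.norm_real,
        Real.norm_of_nonneg (sqrtGaussian_pos w).le]
    have hψe := hψm.1.enorm
    rw [e, intervalIntegral.integral_of_le zero_le_one, ← integral_const_mul]
    calc _ ≤ ∫⁻ t in Set.Ioc (0 : ℝ) 1, ‖z ^ (n + 1) * sqrtGaussian z *
          (((1 - t) ^ n / n.factorial : ℝ) • (z ^ (n + 1) * D (t * z)))‖ₑ :=
          enorm_integral_le_lintegral_enorm _
      _ ≤ ∫⁻ t in Set.Ioc (0 : ℝ) 1, ∫⁻ w,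
          ENNReal.ofReal (remainderIntegrand n z w t) * ‖ψ w‖ₑ := by
          refine lintegral_mono fun t => ?_
          calc _ ≤ ENNReal.ofReal (‖z‖ ^ (2 * (n + 1)) * sqrtGaussian z * |1 - t| ^ n) *
                ‖D (t * z)‖ₑ := by
                rw [← ofReal_norm, ← ofReal_norm, ← ENNReal.ofReal_mul (by
                  have := sqrtGaussian_pos z; positivity)]
                refine ENNReal.ofReal_le_ofReal ?_
                simp only [norm_mul, norm_smul, norm_pow, norm_div, Complex.norm_real,
                  Real.norm_of_nonneg (sqrtGaussian_pos _).le, Real.norm_eq_abs, Nat.abs_cast]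
                have h1 : |1 - t| ^ n / n.factorial ≤ |1 - t| ^ n :=
                  div_le_self (by positivity) (by exact_mod_cast n.factorial_pos)
                have := sqrtGaussian_pos z
                calc _ = ‖z‖ ^ (2 * (n + 1)) * sqrtGaussian z * (|1 - t| ^ n / n.factorial) *
                      ‖D (t * z)‖ := by ring
                  _ ≤ _ := by gcongr
            _ ≤ _ := by
                refine (mul_le_mul_right (hDb t) _).trans_eq ?_
                rw [← lintegral_const_mul'' _ (by fun_prop)]
                refine lintegral_congr fun w => ?_
                rw [← mul_assoc, ← ENNReal.ofReal_mul (by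
                  have := sqrtGaussian_pos z; positivity)]
                rfl
      _ = _ := by
          rw [lintegral_lintegral_swap]
          · refine lintegral_congr fun w => ?_
            exact lintegral_mul_const _ (Continuous.measurable
              ((continuous_remainderIntegrand n).comp
                (f := fun t : ℝ => ((z, w), t)) (by fun_prop))).ennreal_ofReal
          · exact (Continuous.measurable ((continuous_remainderIntegrand n).comp
              (f := fun x : ℝ × ℂ => ((z, x.2), x.1)) (by fun_prop))).ennreal_ofReal.aemeasurable.mul
              hψe.comp_snd
  obtain ⟨C, hC, hrow, hcol⟩ := exists_lintegral_remainderKernel_le n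
  have hs := eLpNorm_lintegral_mul_le (measurable_remainderKernel n) hrow hcol hp hψm.1.enorm
  rw [eLpNorm_enorm] at hs
  have hdiff : MemLp (fun z => fockWeighted (n + 1) f z - T z) p volume := by
    refine ⟨((continuous_fockWeighted _ hf.continuous).aestronglyMeasurable).sub hTm.1,
      ((eLpNorm_mono_enorm fun z => ?_).trans hs).trans_lt (ENNReal.mul_lt_top hC.lt_top hψm.2)⟩
    rw [enorm_eq_self]
    exact hbound z
  convert! hdiff.add hTm using 1
  funext z
  simp

theorem memFockSobolev_iff {m : ℕ} (hm : 0 < m) {p : ℝ≥0∞} (hp : 1 ≤ p) (f : ℂ → ℂ) :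
    MemFockSobolev p m f ↔ ∃ F : FockSobolev p m, F.toFun = f := by
  constructor
  · rintro ⟨hf, -, h⟩
    exact ⟨⟨f, hf, memLp_fockWeighted_of_iteratedDeriv hm hp hf h⟩, rfl⟩
  · rintro ⟨F, rfl⟩
    exact ⟨F.differentiable, (F.differentiable.contDiff (n := (m + 1 : ℕ))).differentiable_iteratedDeriv
      m (by exact_mod_cast Nat.lt_succ_self _),
      memLp_iteratedDeriv_of_fockWeighted hp F.differentiable F.memLp⟩

/-! ### Hölder's inequality and its converse -/

theorem norm_integral_mul_le_eLpNorm {α : Type*} [MeasurableSpace α] {μ : Measure α} {p q : ℝ≥0∞}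
    [ENNReal.HolderConjugate p q] {u v : α → ℂ} (hu : MemLp u p μ) (hv : MemLp v q μ) :
    ‖∫ x, u x * v x ∂μ‖ ≤ (eLpNorm u p μ).toReal * (eLpNorm v q μ).toReal := by
  have h := eLpNorm_smul_le_mul_eLpNorm (p := p) (q := q) (r := 1) hv.1 hu.1
  rw [← ENNReal.toReal_mul]
  have h2 : ‖∫ x, u x * v x ∂μ‖ₑ ≤ eLpNorm (u • v) 1 μ := by
    rw [eLpNorm_one_eq_lintegral_enorm]
    exact enorm_integral_le_lintegral_enorm _
  rw [← toReal_enorm]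
  exact ENNReal.toReal_mono (ENNReal.mul_ne_top hu.2.ne hv.2.ne) (h2.trans h)

/-- Bounded measurable functions with bounded support. -/
structure IsBddSupported (φ : ℂ → ℂ) : Prop where
  measurable : Measurable φ
  bdd : ∃ B, ∀ w, ‖φ w‖ ≤ B
  support : ∃ R, 0 ≤ R ∧ ∀ w, R < ‖w‖ → φ w = 0

theorem IsBddSupported.memLp {φ : ℂ → ℂ} (hφ : IsBddSupported φ) (p : ℝ≥0∞) :
    MemLp φ p volume := by
  obtain ⟨B, hB⟩ := hφ.bdd
  obtain ⟨R, -, hR⟩ := hφ.support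
  have h : MemLp ((Metric.closedBall (0 : ℂ) R).indicator fun _ => B) p volume :=
    memLp_indicator_const p measurableSet_closedBall B (Or.inr measure_closedBall_lt_top.ne)
  refine h.of_le hφ.measurable.aestronglyMeasurable (Filter.Eventually.of_forall fun w => ?_)
  by_cases hw : ‖w‖ ≤ R
  · rw [Set.indicator_of_mem (by simpa using hw)]
    exact (hB w).trans (le_abs_self B)
  · simp [hR w (not_le.1 hw)]

theorem isBddSupported_indicator {s : Set ℂ} (hs : MeasurableSet s) {R : ℝ} (hR : 0 ≤ R)
    (hsR : s ⊆ Metric.closedBall 0 R) {ψ : ℂ → ℂ} (hψ : Measurable ψ) {B : ℝ}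
    (hB : ∀ w ∈ s, ‖ψ w‖ ≤ B) : IsBddSupported (s.indicator ψ) := by
  refine ⟨hψ.indicator hs, ⟨max B 0, fun w => ?_⟩, ⟨R, hR, fun w hw => ?_⟩⟩
  · by_cases hw : w ∈ s
    · rw [Set.indicator_of_mem hw]
      exact (hB w hw).trans (le_max_left _ _)
    · simp [Set.indicator_of_notMem hw]
  · refine Set.indicator_of_notMem (fun h => ?_) _
    have := hsR h
    rw [mem_closedBall_zero_iff] at this
    linarith

theorem HasCompactSupport.isBddSupported {φ : ℂ → ℂ} (h : HasCompactSupport φ)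
    (hc : Continuous φ) : IsBddSupported φ := by
  refine ⟨hc.measurable, h.exists_bound_of_continuous hc, ?_⟩
  obtain ⟨R, hR⟩ := h.isBounded.subset_closedBall 0
  refine ⟨max R 0, le_max_right _ _, fun w hw => image_eq_zero_of_notMem_tsupport fun hm => ?_⟩
  have := hR hm
  rw [mem_closedBall_zero_iff] at this
  exact absurd (this.trans (le_max_left R 0)) (not_le.2 hw)

/-- Testing with `v / |v|` on the part `s` of a ball where `|v| > C` gives `∫ (|v| - C) ≤ 0` over
`s`, which forces `s` to be null. -/
theorem eLpNorm_top_le_of_forall_integral_le {v : ℂ → ℂ} (hv : Continuous v) {C : ℝ} (hC : 0 ≤ C)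
    (h : ∀ φ, IsBddSupported φ → ‖∫ w, φ w * conj (v w)‖ ≤ C * (eLpNorm φ 1 volume).toReal) :
    eLpNorm v ∞ volume ≤ ENNReal.ofReal C := by
  have hball : ∀ n : ℕ, volume (Metric.closedBall (0 : ℂ) n ∩ {w | C < ‖v w‖}) = 0 := by
    intro n
    set s := Metric.closedBall (0 : ℂ) n ∩ {w | C < ‖v w‖} with hs
    have hsm : MeasurableSet s :=
      measurableSet_closedBall.inter (measurableSet_lt measurable_const hv.measurable.norm)
    have hsf : volume s ≠ ∞ :=
      ((measure_mono Set.inter_subset_left).trans_lt measure_closedBall_lt_top).ne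
    have hvi : IntegrableOn (fun w => ‖v w‖) s :=
      (hv.norm.continuousOn.integrableOn_compact (isCompact_closedBall 0 (n : ℝ))).mono_set
        Set.inter_subset_left
    set ψ : ℂ → ℂ := fun w => v w / (‖v w‖ : ℂ) with hψ
    have hψn : ∀ w ∈ s, ‖ψ w‖ = 1 := by
      intro w hw
      have : 0 < ‖v w‖ := hC.trans_lt hw.2
      rw [hψ, norm_div, Complex.norm_real, norm_norm, div_self this.ne']
    have hm : Measurable v := hv.measurable
    have h1 := h (s.indicator ψ) (isBddSupported_indicator hsm (Nat.cast_nonneg n)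
      Set.inter_subset_left (by fun_prop) (B := 1) fun w hw => (hψn w hw).le)
    have h2 : eLpNorm (s.indicator ψ) 1 volume = volume s := by
      rw [eLpNorm_indicator_eq_eLpNorm_restrict hsm, eLpNorm_one_eq_lintegral_enorm,
        setLIntegral_congr_fun (g := fun _ => 1) hsm fun w hw => ?_, setLIntegral_one]
      simp [← ofReal_norm, hψn w hw]
    have h3 : ∫ w, s.indicator ψ w * conj (v w) = ((∫ w in s, ‖v w‖ : ℝ) : ℂ) := by
      rw [← integral_complex_ofReal, ← integral_indicator hsm]
      congr 1
      funext w
      by_cases hw : w ∈ s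
      · have : (‖v w‖ : ℂ) ≠ 0 := by exact_mod_cast (hC.trans_lt hw.2).ne'
        rw [Set.indicator_of_mem hw, Set.indicator_of_mem hw, hψ, div_mul_eq_mul_div,
          Complex.mul_conj, Complex.normSq_eq_norm_sq, div_eq_iff this]
        push_cast
        ring
      · simp [Set.indicator_of_notMem hw]
    rw [h2, h3, Complex.norm_real] at h1
    have h4 : ∫ w in s, (‖v w‖ - C) ≤ 0 := by
      rw [integral_sub hvi (integrableOn_const hsf), setIntegral_const, smul_eq_mul]
      have := (le_abs_self _).trans h1
      rw [measureReal_def]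
      linarith
    by_contra hne
    have h5 : 0 < ∫ w in s, (‖v w‖ - C) := by
      rw [setIntegral_pos_iff_support_of_nonneg_ae]
      · refine (pos_iff_ne_zero.2 hne).trans_le (measure_mono fun w hw => ⟨?_, hw⟩)
        exact (sub_pos.2 hw.2).ne'
      · refine (ae_restrict_iff' hsm).2 (Filter.Eventually.of_forall fun w hw => ?_)
        exact (sub_pos.2 hw.2).le
      · exact hvi.sub (integrableOn_const hsf)
    linarith
  rw [eLpNorm_exponent_top]
  refine essSup_le_of_ae_le _ ?_
  have h0 : volume {w | C < ‖v w‖} = 0 := by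
    rw [← Set.univ_inter {w | C < ‖v w‖}, ← Metric.iUnion_closedBall_nat (0 : ℂ), Set.iUnion_inter]
    exact measure_iUnion_null hball
  have h1 : ∀ᵐ w, ‖v w‖ ≤ C := by simpa [ae_iff] using h0
  filter_upwards [h1] with w hw
  rw [← ofReal_norm]
  exact ENNReal.ofReal_le_ofReal hw

theorem lintegral_le_of_forall_closedBall {f : ℂ → ℝ≥0∞} {A : ℝ≥0∞}
    (h : ∀ n : ℕ, ∫⁻ w in Metric.closedBall 0 (n : ℝ), f w ≤ A) : ∫⁻ w, f w ≤ A := by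
  rw [← setLIntegral_univ, ← Metric.iUnion_closedBall_nat (0 : ℂ), setLIntegral_iUnion_of_directed]
  · exact iSup_le h
  · exact Monotone.directed_le fun a b hab =>
      Metric.closedBall_subset_closedBall (by exact_mod_cast hab)

/-- The test function is the extremal one, `|v| ^ (b - 2) v`, cut off to a ball. With `J` the
integral of `|v| ^ b` over the ball, the hypothesis reads `J ≤ C * J ^ (1/a)`. The cut-off makes `J`
finite, so division gives `J ^ (1/b) ≤ C`, and the radius tends to infinity. -/
theorem eLpNorm_le_of_forall_integral_le_of_ne_top {p q : ℝ≥0∞} [ENNReal.HolderConjugate p q]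
    (hp : p ≠ ∞) (hq : q ≠ ∞) {v : ℂ → ℂ} (hv : Continuous v) {C : ℝ} (hC : 0 ≤ C)
    (h : ∀ φ, IsBddSupported φ → ‖∫ w, φ w * conj (v w)‖ ≤ C * (eLpNorm φ p volume).toReal) :
    eLpNorm v q volume ≤ ENNReal.ofReal C := by
  have hpq := ENNReal.HolderConjugate.toReal_of_ne_top hp hq
  set a := p.toReal
  set b := q.toReal with hb
  have hp0 : p ≠ 0 := fun h0 => by simpa [a, h0] using hpq.pos
  have hq0 : q ≠ 0 := fun h0 => by simpa [b, h0] using hpq.symm.pos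
  have hb0 := hpq.symm.pos
  have hb1 := hpq.symm.lt
  have hball : ∀ n : ℕ, ∫⁻ w in Metric.closedBall 0 (n : ℝ), ‖v w‖ₑ ^ b ≤ ENNReal.ofReal C ^ b := by
    intro n
    set s := Metric.closedBall (0 : ℂ) n
    have hsm : MeasurableSet s := measurableSet_closedBall
    have hcb : Continuous fun w => ‖v w‖ ^ b := hv.norm.rpow_const fun _ => Or.inr hb0.le
    set J := ∫ w in s, ‖v w‖ ^ b with hJ
    have hJ0 : 0 ≤ J := integral_nonneg fun w => by positivity
    have hJe : ∫⁻ w in s, ENNReal.ofReal (‖v w‖ ^ b) = ENNReal.ofReal J := by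
      rw [hJ, ofReal_integral_eq_lintegral_ofReal]
      · exact hcb.continuousOn.integrableOn_compact (isCompact_closedBall 0 (n : ℝ))
      · exact Filter.Eventually.of_forall fun w => by positivity
    -- The exponent `b - 2` may be negative; at zeros of `v` the value of the power is irrelevant
    -- because the factor `v w` vanishes.
    set ψ : ℂ → ℂ := fun w => ((‖v w‖ ^ (b - 2) : ℝ) : ℂ) * v w with hψ
    have hψn : ∀ w, ‖ψ w‖ = ‖v w‖ ^ (b - 1) := by
      intro w
      rw [hψ, norm_mul, Complex.norm_real, Real.norm_of_nonneg (by positivity)]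
      rcases (norm_nonneg (v w)).eq_or_lt with h0 | h0
      · rw [← h0, mul_zero, Real.zero_rpow (by linarith)]
      · nth_rewrite 2 [← Real.rpow_one ‖v w‖]
        rw [← Real.rpow_add h0]
        ring_nf
    have hψc : Continuous fun w => ‖v w‖ ^ (b - 1) :=
      hv.norm.rpow_const fun _ => Or.inr (by linarith)
    obtain ⟨B, hB⟩ := (isCompact_closedBall (0 : ℂ) n).exists_bound_of_continuousOn hψc.continuousOn
    have hm : Measurable v := hv.measurable
    have h1 := h (s.indicator ψ) (isBddSupported_indicator hsm (Nat.cast_nonneg n) subset_rfl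
      (by fun_prop) (B := B) fun w hw => by
        rw [hψn]; exact (le_abs_self _).trans (hB w hw))
    have h2 : eLpNorm (s.indicator ψ) p volume = ENNReal.ofReal (J ^ (1 / a)) := by
      rw [eLpNorm_indicator_eq_eLpNorm_restrict hsm,
        eLpNorm_eq_lintegral_rpow_enorm_toReal hp0 hp,
        ← ENNReal.ofReal_rpow_of_nonneg hJ0 (by have := hpq.pos; positivity), ← hJe]
      congr 1
      refine lintegral_congr fun w => ?_
      rw [← ofReal_norm, hψn, ENNReal.ofReal_rpow_of_nonneg (by positivity) hpq.nonneg,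
        ← Real.rpow_mul (norm_nonneg _), hpq.symm.sub_one_mul_conj]
    have h3 : ∫ w, s.indicator ψ w * conj (v w) = (J : ℂ) := by
      rw [hJ, ← integral_complex_ofReal, ← integral_indicator hsm]
      congr 1
      funext w
      by_cases hw : w ∈ s
      · rw [Set.indicator_of_mem hw, Set.indicator_of_mem hw, hψ, mul_assoc, Complex.mul_conj,
          Complex.normSq_eq_norm_sq, ← Complex.ofReal_mul]
        congr 1
        rcases (norm_nonneg (v w)).eq_or_lt with h0 | h0
        · rw [← h0, Real.zero_rpow hb0.ne']
          simp
        · rw [← Real.rpow_natCast, ← Real.rpow_add h0]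
          norm_num
      · simp [Set.indicator_of_notMem hw]
    rw [h2, h3, Complex.norm_real, Real.norm_of_nonneg hJ0,
      ENNReal.toReal_ofReal (by positivity)] at h1
    have h4 : J ≤ C ^ b := by
      rcases hJ0.eq_or_lt with h0 | h0
      · rw [← h0]; positivity
      · have h5 : J ^ (1 / b) ≤ C := by
          have h6 : J ^ (1 / b) * J ^ (1 / a) = J := by
            rw [← Real.rpow_add h0, one_div, one_div, hpq.symm.inv_add_inv_eq_one, Real.rpow_one]
          exact le_of_mul_le_mul_right (h6.le.trans h1) (by positivity)
        calc J = (J ^ (1 / b)) ^ b := by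
              rw [← Real.rpow_mul hJ0, one_div_mul_cancel hb0.ne', Real.rpow_one]
          _ ≤ C ^ b := by gcongr
    calc _ = ∫⁻ w in s, ENNReal.ofReal (‖v w‖ ^ b) := by
          refine lintegral_congr fun w => ?_
          rw [← ofReal_norm, ENNReal.ofReal_rpow_of_nonneg (norm_nonneg _) hb0.le]
      _ ≤ _ := by
          rw [hJe, ENNReal.ofReal_rpow_of_nonneg hC hb0.le]
          exact ENNReal.ofReal_le_ofReal h4
  rw [eLpNorm_eq_lintegral_rpow_enorm_toReal hq0 hq, ← hb]
  calc _ ≤ (ENNReal.ofReal C ^ b) ^ (1 / b) := by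
        gcongr
        exact lintegral_le_of_forall_closedBall hball
    _ = _ := by rw [← ENNReal.rpow_mul, mul_one_div_cancel hb0.ne', ENNReal.rpow_one]

/-- The converse of Hölder's inequality for continuous functions on the plane. -/
theorem eLpNorm_le_of_forall_integral_le {p q : ℝ≥0∞} [hpq : ENNReal.HolderConjugate p q]
    (hp : p ≠ ∞) {v : ℂ → ℂ} (hv : Continuous v) {C : ℝ} (hC : 0 ≤ C)
    (h : ∀ φ, IsBddSupported φ → ‖∫ w, φ w * conj (v w)‖ ≤ C * (eLpNorm φ p volume).toReal) :
    eLpNorm v q volume ≤ ENNReal.ofReal C := by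
  rcases eq_or_ne q ∞ with rfl | hq
  · have hp1 : p = 1 := by simpa using hpq.inv_add_inv_eq_inv
    subst hp1
    exact eLpNorm_top_le_of_forall_integral_le hv hC h
  · exact eLpNorm_le_of_forall_integral_le_of_ne_top hp hq hv hC h

/-! ### Power series and division by `z ^ m` -/

theorem differentiable_tsum_mul_pow {a : ℕ → ℂ} (h : ∀ z : ℂ, Summable fun n => a n * z ^ n) :
    Differentiable ℂ fun z => ∑' n, a n * z ^ n := by
  intro z
  -- Summability at the single point `‖z‖ + 1` dominates the series on the whole disc of that
  -- radius.
  have hR := (h ((‖z‖ + 1 : ℝ) : ℂ)).norm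
  have hd := Complex.differentiableOn_tsum_of_summable_norm (F := fun n z => a n * z ^ n)
    (U := Metric.ball 0 (‖z‖ + 1)) hR (fun n => by fun_prop) Metric.isOpen_ball ?_
  · exact hd.differentiableAt (Metric.isOpen_ball.mem_nhds (by simp))
  · intro n w hw
    rw [mem_ball_zero_iff] at hw
    rw [norm_mul, norm_mul, norm_pow, norm_pow, Complex.norm_real,
      Real.norm_of_nonneg (by positivity : 0 ≤ ‖z‖ + 1)]
    gcongr

theorem eq_of_pow_mul_eq {f g : ℂ → ℂ} (hf : Continuous f) (hg : Continuous g) (m : ℕ)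
    (h : ∀ z, z ^ m * f z = z ^ m * g z) : f = g :=
  hf.ext_on (dense_compl_singleton (0 : ℂ)) hg fun z hz => mul_left_cancel₀ (pow_ne_zero m hz) (h z)

/-- The Taylor coefficients at the origin. -/
def taylorCoeff (h : ℂ → ℂ) (n : ℕ) : ℂ := iteratedDeriv n h 0 / n.factorial

theorem hasSum_taylorCoeff {h : ℂ → ℂ} (hd : Differentiable ℂ h) (z : ℂ) :
    HasSum (fun n => taylorCoeff h n * z ^ n) (h z) := by
  convert! Complex.hasSum_taylorSeries_of_entire hd 0 z using 2 with n
  simp only [taylorCoeff, sub_zero, smul_eq_mul]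
  ring

/-- The quotient by `z ^ m` of the Taylor remainder of order `m` at the origin. -/
def taylorTail (m : ℕ) (h : ℂ → ℂ) (z : ℂ) : ℂ := ∑' n, taylorCoeff h (n + m) * z ^ n

theorem hasSum_taylorTail (m : ℕ) {h : ℂ → ℂ} (hd : Differentiable ℂ h) (z : ℂ) :
    HasSum (fun n => taylorCoeff h (n + m) * z ^ n) (taylorTail m h z) := by
  refine Summable.hasSum ?_
  rcases eq_or_ne z 0 with rfl | hz
  · refine summable_of_ne_finset_zero (s := {0}) fun n hn => ?_
    simp [zero_pow (by simpa using hn : n ≠ 0)]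
  · have h1 := ((summable_nat_add_iff m).2 (hasSum_taylorCoeff hd z).summable).mul_left (z ^ m)⁻¹
    refine h1.congr fun n => ?_
    rw [pow_add]
    field_simp

theorem differentiable_taylorTail (m : ℕ) {h : ℂ → ℂ} (hd : Differentiable ℂ h) :
    Differentiable ℂ (taylorTail m h) :=
  differentiable_tsum_mul_pow fun z => (hasSum_taylorTail m hd z).summable

theorem pow_mul_taylorTail (m : ℕ) {h : ℂ → ℂ} (hd : Differentiable ℂ h) (z : ℂ) :
    z ^ m * taylorTail m h z = h z - ∑ j ∈ Finset.range m, taylorCoeff h j * z ^ j := by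
  have h1 := (hasSum_nat_add_iff' m).2 (hasSum_taylorCoeff hd z)
  refine HasSum.unique ?_ h1
  convert! (hasSum_taylorTail m hd z).mul_left (z ^ m) using 2 with n
  ring

theorem taylorTail_pow_mul (m : ℕ) {f : ℂ → ℂ} (hf : Differentiable ℂ f) :
    taylorTail m (fun z => z ^ m * f z) = f := by
  have hd : Differentiable ℂ fun z => z ^ m * f z := by fun_prop
  refine eq_of_pow_mul_eq (differentiable_taylorTail m hd).continuous hf.continuous m fun z => ?_
  rw [pow_mul_taylorTail m hd, Finset.sum_eq_zero, sub_zero]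
  intro j hj
  have h1 := (natCast_le_analyticOrderAt_iff_iteratedDeriv_eq_zero (n := m) (hd.analyticAt 0)).1
    ((natCast_le_analyticOrderAt (hd.analyticAt 0)).2
      ⟨f, hf.analyticAt 0, Filter.Eventually.of_forall fun z => by simp⟩) j (Finset.mem_range.1 hj)
  simp [taylorCoeff, h1]

/-- In the tail each term of index `k ≥ M` is at most `2 ^ (-M) * 2 ^ k` times its bound `B (R|z|) ^
k / k!`. This trades geometric decay in `M` for the growth `exp (2R|z|)`, which the Gaussian weight
absorbs. -/
theorem norm_sub_taylor_le {h : ℂ → ℂ} (hd : Differentiable ℂ h) {B R : ℝ}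
    (hB : ∀ n, ‖iteratedDeriv n h 0‖ ≤ B * R ^ n) (hR : 0 ≤ R) (M : ℕ) (z : ℂ) :
    ‖h z - ∑ j ∈ Finset.range M, taylorCoeff h j * z ^ j‖ ≤
      B * (1 / 2) ^ M * Real.exp (2 * R * ‖z‖) := by
  have hB0 : 0 ≤ B := by simpa using (norm_nonneg _).trans (hB 0)
  have h1 := (hasSum_nat_add_iff' M).2 (hasSum_taylorCoeff hd z)
  have h2 : HasSum (fun n : ℕ => (2 * R * ‖z‖) ^ n / n.factorial) (Real.exp (2 * R * ‖z‖)) := by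
    rw [Real.exp_eq_exp_ℝ]
    exact NormedSpace.expSeries_div_hasSum_exp _
  have h3 := ((hasSum_nat_add_iff' M).2 h2).mul_left (B * (1 / 2) ^ M)
  refine (h1.norm_le_of_bounded h3 fun n => ?_).trans ?_
  · rw [taylorCoeff, norm_mul, norm_div, norm_pow, Complex.norm_natCast]
    have h4 : (1 : ℝ) ≤ 2 ^ n := one_le_pow₀ one_le_two
    calc _ ≤ B * R ^ (n + M) / ((n + M).factorial : ℝ) * ‖z‖ ^ (n + M) := by
          gcongr
          exact hB _
      _ ≤ 2 ^ n * (B * R ^ (n + M) / ((n + M).factorial : ℝ) * ‖z‖ ^ (n + M)) :=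
          le_mul_of_one_le_left (by positivity) h4
      _ = _ := by
          rw [mul_pow, mul_pow, pow_add 2]
          field_simp
          rw [mul_assoc _ ((1 / 2 : ℝ) ^ M), ← mul_pow]
          norm_num
  · gcongr
    exact sub_le_self _ (Finset.sum_nonneg fun n _ => by positivity)

theorem GaussTame.iteratedDeriv_fockProj_zero {φ : ℂ → ℂ} (hφ : GaussTame φ) (n : ℕ) :
    iteratedDeriv n (fockProj φ) 0 = ∫ w, φ w * (conj w ^ n * sqrtGaussian w) := by
  rw [hφ.iteratedDeriv_fockProj, fockProj]
  refine integral_congr_ae (Filter.Eventually.of_forall fun w => ?_)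
  simp
  ring

theorem memLp_conj_pow_mul_sqrtGaussian (n : ℕ) (q : ℝ≥0∞) :
    MemLp (fun z : ℂ => conj z ^ n * (sqrtGaussian z : ℂ)) q volume := by
  refine (memLp_pow_mul_sqrtGaussian n q).of_le (Continuous.aestronglyMeasurable (by fun_prop))
    (Filter.Eventually.of_forall fun z => le_of_eq ?_)
  simp

/-! ### The bounded map from `L^p` to `F^{p,m}` -/

namespace FockSobolev

variable {p q : ℝ≥0∞} {m : ℕ}

/-- The map to the underlying function, as a linear map. -/
def toFunLinear : FockSobolev p m →ₗ[ℂ] ℂ → ℂ where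
  toFun := toFun
  map_add' := toFun_add
  map_smul' := toFun_smul

/-- The monomial `z ^ n`. -/
def monomial (p : ℝ≥0∞) (m n : ℕ) : FockSobolev p m :=
  ⟨fun z => z ^ n, by fun_prop, memLp_fockWeighted_pow m n p⟩

/-- The quotient by `z ^ m` of the projection of `φ` to the functions in the Fock space which
vanish to the order `m` at the origin, up to a factor `π`. -/
def ofLp [hp : Fact (1 ≤ p)] (m : ℕ) (φ : ℂ → ℂ) (hφ : MemLp φ p volume) : FockSobolev p m :=
  ⟨taylorTail m (fockProj φ), by
    have hd := (hφ.gaussTame hp.out).differentiable_fockProj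
    refine ⟨differentiable_taylorTail m hd, ?_⟩
    have h : MemLp (fun z => fockProj φ z * sqrtGaussian z - ∑ j ∈ Finset.range m,
        taylorCoeff (fockProj φ) j * (z ^ j * sqrtGaussian z)) p volume :=
      (memLp_fockProj hp.out hφ).sub
        (memLp_finsetSum _ fun j _ => (memLp_pow_mul_sqrtGaussian j p).const_mul _)
    convert! h using 2 with z
    rw [fockWeighted_eq, pow_mul_taylorTail m hd, sub_mul, Finset.sum_mul]
    simp only [mul_assoc]⟩

variable [hp : Fact (1 ≤ p)]

theorem fockWeighted_ofLp (φ : ℂ → ℂ) (hφ : MemLp φ p volume) (z : ℂ) :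
    fockWeighted m (ofLp m φ hφ) z = fockProj φ z * sqrtGaussian z - ∑ j ∈ Finset.range m,
        taylorCoeff (fockProj φ) j * (z ^ j * sqrtGaussian z) := by
  have hd := (hφ.gaussTame hp.out).differentiable_fockProj
  change z ^ m * taylorTail m (fockProj φ) z * sqrtGaussian z = _
  rw [pow_mul_taylorTail m hd, sub_mul, Finset.sum_mul]
  simp only [mul_assoc]

theorem norm_taylorCoeff_fockProj_le [ENNReal.HolderConjugate p q] {φ : ℂ → ℂ}
    (hφ : MemLp φ p volume) (n : ℕ) :
    ‖taylorCoeff (fockProj φ) n‖ ≤ (eLpNorm φ p volume).toReal *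
      (eLpNorm (fun z : ℂ => conj z ^ n * (sqrtGaussian z : ℂ)) q volume).toReal := by
  rw [taylorCoeff, (hφ.gaussTame hp.out).iteratedDeriv_fockProj_zero, norm_div,
    Complex.norm_natCast]
  exact (div_le_self (norm_nonneg _) (by exact_mod_cast n.factorial_pos)).trans
    (norm_integral_mul_le_eLpNorm hφ (memLp_conj_pow_mul_sqrtGaussian n q))

/-- Multiplication by `z ^ m` turns `ofLp m φ` into `fockProj φ` minus finitely many Taylor terms.
The first is bounded by Schur's test, and each Taylor coefficient is a moment of `φ`, bounded by
Hölder's inequality. -/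
theorem exists_norm_ofLp_le (p : ℝ≥0∞) [hp : Fact (1 ≤ p)] (m : ℕ) :
    ∃ C : ℝ, 0 ≤ C ∧ ∀ (φ : ℂ → ℂ) (hφ : MemLp φ p volume),
      ‖ofLp m φ hφ‖ ≤ C * (eLpNorm φ p volume).toReal := by
  set q := ENNReal.conjExponent p
  have := ENNReal.HolderConjugate.conjExponent hp.out
  set A : ℕ → ℝ := fun j =>
    (eLpNorm (fun z : ℂ => conj z ^ j * (sqrtGaussian z : ℂ)) q volume).toReal with hA
  set B : ℕ → ℝ := fun j =>
    (eLpNorm (fun z : ℂ => z ^ j * (sqrtGaussian z : ℂ)) p volume).toReal with hB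
  have hc := fockConst_pos p m hp.out
  refine ⟨fockConst p m * (sqrtGaussianMass.toReal + ∑ j ∈ Finset.range m, A j * B j), ?_, ?_⟩
  · have : ∀ j, 0 ≤ A j * B j := fun j => mul_nonneg ENNReal.toReal_nonneg ENNReal.toReal_nonneg
    exact mul_nonneg hc.le (add_nonneg ENNReal.toReal_nonneg (Finset.sum_nonneg fun j _ => this j))
  · intro φ hφ
    rw [norm_def, mul_assoc]
    refine mul_le_mul_of_nonneg_left ?_ hc.le
    have h0 := memLp_fockProj hp.out hφ
    have h1 : ∀ j, MemLp (fun z : ℂ => taylorCoeff (fockProj φ) j * (z ^ j * sqrtGaussian z)) p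
        volume := fun j => (memLp_pow_mul_sqrtGaussian j p).const_mul _
    have e : fockWeighted m (ofLp m φ hφ) = (fun z => fockProj φ z * (sqrtGaussian z : ℂ)) -
        ∑ j ∈ Finset.range m, fun z : ℂ => taylorCoeff (fockProj φ) j * (z ^ j * sqrtGaussian z) := by
      funext z
      rw [fockWeighted_ofLp, Pi.sub_apply, Finset.sum_apply]
    rw [e]
    have hsum : eLpNorm (∑ j ∈ Finset.range m, fun z : ℂ =>
        taylorCoeff (fockProj φ) j * (z ^ j * sqrtGaussian z)) p volume ≤
        ∑ j ∈ Finset.range m, eLpNorm (fun z : ℂ =>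
          taylorCoeff (fockProj φ) j * (z ^ j * sqrtGaussian z)) p volume :=
      eLpNorm_sum_le (fun j _ => (h1 j).1) hp.out
    have hfin : ∀ j ∈ Finset.range m, eLpNorm (fun z : ℂ =>
          taylorCoeff (fockProj φ) j * (z ^ j * sqrtGaussian z)) p volume ≠ ∞ :=
      fun j _ => (h1 j).2.ne
    calc _ ≤ (eLpNorm (fun z => fockProj φ z * (sqrtGaussian z : ℂ)) p volume +
          ∑ j ∈ Finset.range m, eLpNorm (fun z : ℂ =>
          taylorCoeff (fockProj φ) j * (z ^ j * sqrtGaussian z)) p volume).toReal := by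
          refine ENNReal.toReal_mono (ENNReal.add_ne_top.2 ⟨h0.2.ne, ENNReal.sum_ne_top.2 hfin⟩) ?_
          refine (eLpNorm_sub_le h0.1 (memLp_finsetSum' _ fun j _ => h1 j).1 hp.out).trans ?_
          gcongr
      _ = (eLpNorm (fun z => fockProj φ z * (sqrtGaussian z : ℂ)) p volume).toReal +
          ∑ j ∈ Finset.range m, (eLpNorm (fun z : ℂ =>
          taylorCoeff (fockProj φ) j * (z ^ j * sqrtGaussian z)) p volume).toReal := by
          rw [ENNReal.toReal_add h0.2.ne (ENNReal.sum_ne_top.2 hfin), ENNReal.toReal_sum hfin]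
      _ ≤ sqrtGaussianMass.toReal * (eLpNorm φ p volume).toReal +
          ∑ j ∈ Finset.range m, A j * B j * (eLpNorm φ p volume).toReal := by
          refine add_le_add ?_ (Finset.sum_le_sum fun j _ => ?_)
          · rw [← ENNReal.toReal_mul]
            exact ENNReal.toReal_mono (ENNReal.mul_ne_top sqrtGaussianMass_ne_top hφ.2.ne)
              (eLpNorm_fockProj_le hp.out hφ.1)
          · have h2 := eLpNorm_const_smul (taylorCoeff (fockProj φ) j)
              (fun z : ℂ => z ^ j * (sqrtGaussian z : ℂ)) p volume
            have h3 : (eLpNorm (fun z : ℂ =>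
                taylorCoeff (fockProj φ) j * (z ^ j * sqrtGaussian z)) p volume).toReal =
                ‖taylorCoeff (fockProj φ) j‖ * B j := by
              rw [hB, ← toReal_enorm, ← ENNReal.toReal_mul, ← h2]
              rfl
            rw [h3]
            have h4 := norm_taylorCoeff_fockProj_le (q := q) hφ j
            have h5 : 0 ≤ B j := ENNReal.toReal_nonneg
            calc _ ≤ ((eLpNorm φ p volume).toReal * A j) * B j := by gcongr
              _ = _ := by ring
      _ = _ := by rw [add_mul, Finset.sum_mul]

theorem ofLp_sub {φ ψ : ℂ → ℂ} (hφ : MemLp φ p volume) (hψ : MemLp ψ p volume) :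
    ofLp m (φ - ψ) (hφ.sub hψ) = ofLp m φ hφ - ofLp m ψ hψ := by
  have hφt := hφ.gaussTame hp.out
  have hψt := hψ.gaussTame hp.out
  have hs : fockProj (φ - ψ) = fun z => fockProj φ z - fockProj ψ z := by
    funext z
    unfold fockProj
    simp only [Pi.sub_apply, sub_mul]
    exact integral_sub (hφt.integrable_fockProj z) (hψt.integrable_fockProj z)
  have hc : ∀ n, taylorCoeff (fockProj (φ - ψ)) n =
      taylorCoeff (fockProj φ) n - taylorCoeff (fockProj ψ) n := by
    intro n
    rw [taylorCoeff, hs, iteratedDeriv_fun_sub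
      (hφt.differentiable_fockProj.contDiff (n := n)).contDiffAt
      (hψt.differentiable_fockProj.contDiff (n := n)).contDiffAt, sub_div]
    rfl
  refine toFun_injective ?_
  funext z
  refine HasSum.unique (hasSum_taylorTail m
    ((hφ.sub hψ).gaussTame hp.out).differentiable_fockProj z) ?_
  simp only [hc, sub_mul]
  exact (hasSum_taylorTail m hφt.differentiable_fockProj z).sub
    (hasSum_taylorTail m hψt.differentiable_fockProj z)

theorem fockProj_fockWeighted (f : FockSobolev p m) :
    fockProj (fockWeighted m f) = fun z => z ^ m * (Real.pi * f z) := by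
  have hd : Differentiable ℂ fun z => z ^ m * f z := by
    have := f.differentiable
    fun_prop
  funext z
  have h := GaussTame.fockProj_mul_sqrtGaussian hd (f.memLp.gaussTame hp.out) z
  rw [mul_left_comm, ← h]
  rfl

/-- Up to the factor `π`, `ofLp` is a left inverse of the embedding `fockWeighted m` into `L^p`: `z
^ m * f` is reproduced, and vanishes to order `m` at the origin, so no Taylor terms are removed. -/
theorem ofLp_fockWeighted (f : FockSobolev p m) :
    ofLp m (fockWeighted m f) f.memLp = (Real.pi : ℂ) • f := by
  refine toFun_injective ?_
  change taylorTail m (fockProj (fockWeighted m f)) = _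
  rw [fockProj_fockWeighted]
  exact taylorTail_pow_mul m (f.differentiable.const_mul _)

end FockSobolev

/-- The derivatives at the origin are moments of `φ` against `conj w ^ n`, and `|w| ≤ R` on the
support. -/
theorem IsBddSupported.exists_norm_iteratedDeriv_fockProj_le {φ : ℂ → ℂ} (hφ : IsBddSupported φ) :
    ∃ B R : ℝ, 0 ≤ R ∧ ∀ n, ‖iteratedDeriv n (fockProj φ) 0‖ ≤ B * R ^ n := by
  have ht := (hφ.memLp 1).gaussTame le_rfl
  obtain ⟨R, hR0, hR⟩ := hφ.support
  have hi : Integrable fun w => ‖φ w‖ * sqrtGaussian w := by simpa using ht.2 0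
  refine ⟨∫ w, ‖φ w‖ * sqrtGaussian w, R, hR0, fun n => ?_⟩
  rw [ht.iteratedDeriv_fockProj_zero, ← integral_mul_const]
  refine norm_integral_le_of_norm_le (hi.mul_const _) (Filter.Eventually.of_forall fun w => ?_)
  have hg := sqrtGaussian_pos w
  rw [norm_mul, norm_mul, norm_pow, RCLike.norm_conj, Complex.norm_real, Real.norm_of_nonneg hg.le]
  by_cases hw : ‖w‖ ≤ R
  · calc _ ≤ ‖φ w‖ * (R ^ n * sqrtGaussian w) := by gcongr
      _ = _ := by ring
  · simp [hR w (not_le.1 hw)]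

/-! ### The pairing and approximation by polynomials -/

namespace FockSobolev

variable {p q : ℝ≥0∞} {m : ℕ}

/-- Splitting `|z| ^ (2m)` as `z ^ m * conj z ^ m` and halving the Gaussian makes the pairing an
unweighted one between `L^p` and `L^q`. -/
theorem pairing_eq (f : FockSobolev p m) (g : FockSobolev q m) (z : ℂ) :
    f z * conj (g z) * (Real.exp (-‖z‖ ^ 2) : ℂ) * (‖z‖ : ℂ) ^ (2 * m) =
      fockWeighted m f z * conj (fockWeighted m g z) := by
  have h : (z ^ m * conj z ^ m : ℂ) = (‖z‖ : ℂ) ^ (2 * m) := by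
    rw [← mul_pow, Complex.mul_conj, Complex.normSq_eq_norm_sq, pow_mul]
    push_cast
    rfl
  rw [← h, ← sqrtGaussian_mul_self, fockWeighted_eq, fockWeighted_eq]
  simp only [map_mul, map_pow, Complex.conj_ofReal]
  push_cast
  ring

theorem memLp_conj_fockWeighted (g : FockSobolev q m) :
    MemLp (fun z => conj (fockWeighted m g z)) q volume :=
  g.memLp.of_le (Complex.continuous_conj.comp_aestronglyMeasurable g.memLp.1)
    (Filter.Eventually.of_forall fun z => by simp)

theorem eLpNorm_conj (v : ℂ → ℂ) (q : ℝ≥0∞) :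
    eLpNorm (fun z => conj (v z)) q volume = eLpNorm v q volume :=
  eLpNorm_congr_norm_ae (Filter.Eventually.of_forall fun z => by simp)

theorem integrable_pairing [ENNReal.HolderConjugate p q] (f : FockSobolev p m)
    (g : FockSobolev q m) :
    Integrable (fun z => fockWeighted m f z * conj (fockWeighted m g z)) :=
  memLp_one_iff_integrable.1 (MemLp.mul' g.memLp_conj_fockWeighted f.memLp)

theorem norm_integral_mul_conj_fockWeighted_le [ENNReal.HolderConjugate p q] {u : ℂ → ℂ}
    (hu : MemLp u p volume)
    (g : FockSobolev q m) :
    ‖∫ z, u z * conj (fockWeighted m g z)‖ ≤ (eLpNorm u p volume).toReal *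
      (eLpNorm (fockWeighted m g) q volume).toReal := by
  rw [← eLpNorm_conj (fockWeighted m g)]
  exact norm_integral_mul_le_eLpNorm hu g.memLp_conj_fockWeighted

theorem fockWeighted_sub_sum (F : FockSobolev p m) (a : ℕ → ℂ) (N : ℕ) (z : ℂ) :
    fockWeighted m (F - ∑ n ∈ Finset.range N, a n • monomial p m n).toFun z =
      (z ^ m * F z - ∑ n ∈ Finset.range N, a n * z ^ (m + n)) * sqrtGaussian z := by
  have h : (F - ∑ n ∈ Finset.range N, a n • monomial p m n).toFun =
      F.toFun - ∑ n ∈ Finset.range N, a n • (monomial p m n).toFun := by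
    have h1 := map_sub (toFunLinear (p := p) (m := m)) F
      (∑ n ∈ Finset.range N, a n • monomial p m n)
    rw [map_sum] at h1
    simp only [map_smul] at h1
    exact h1
  rw [fockWeighted_eq, h, Pi.sub_apply, Finset.sum_apply, mul_sub, Finset.mul_sum]
  congr 2
  refine Finset.sum_congr rfl fun n _ => ?_
  rw [Pi.smul_apply, smul_eq_mul, mul_left_comm, pow_add]
  rfl

variable [hp : Fact (1 ≤ p)]

/-- Bounded support makes the derivatives of `fockProj φ` at the origin grow at most geometrically,
so `norm_sub_taylor_le` bounds the weighted tail by `2 ^ (-(N + m))` times a fixed function in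
`L^p`. -/
theorem tendsto_sum_monomial {φ : ℂ → ℂ} (hφ : IsBddSupported φ) :
    Filter.Tendsto (fun N => ∑ n ∈ Finset.range N,
      taylorCoeff (fockProj φ) (n + m) • monomial p m n) Filter.atTop
      (nhds (ofLp m φ (hφ.memLp p))) := by
  have hd := ((hφ.memLp p).gaussTame hp.out).differentiable_fockProj
  obtain ⟨B, R, hR, hB⟩ := hφ.exists_norm_iteratedDeriv_fockProj_le
  have hB0 : 0 ≤ B := by simpa using (norm_nonneg _).trans (hB 0)
  set W : ℂ → ℝ := fun z => Real.exp (2 * R * ‖z‖) * sqrtGaussian z with hW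
  have hWm : MemLp W p volume := memLp_exp_mul_norm_mul_sqrtGaussian (2 * R) p
  have hbound : ∀ N, ‖∑ n ∈ Finset.range N, taylorCoeff (fockProj φ) (n + m) • monomial p m n -
      ofLp m φ (hφ.memLp p)‖ ≤
      fockConst p m * (B * (1 / 2) ^ (N + m) * (eLpNorm W p volume).toReal) := by
    intro N
    rw [← norm_neg, neg_sub, norm_def]
    refine mul_le_mul_of_nonneg_left ?_ (fockConst_pos p m hp.out).le
    have h1 := eLpNorm_const_smul (B * (1 / 2) ^ (N + m)) W p volume
    have h0 : 0 ≤ B * (1 / 2) ^ (N + m) := by positivity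
    have h2 : B * (1 / 2) ^ (N + m) * (eLpNorm W p volume).toReal =
        (eLpNorm ((B * (1 / 2) ^ (N + m)) • W) p volume).toReal := by
      rw [h1, ENNReal.toReal_mul, toReal_enorm, Real.norm_of_nonneg h0]
    rw [h2]
    refine ENNReal.toReal_mono (hWm.const_smul _).2.ne (eLpNorm_mono fun z => ?_)
    have hg := sqrtGaussian_pos z
    rw [fockWeighted_sub_sum]
    change ‖(z ^ m * taylorTail m (fockProj φ) z - _) * _‖ ≤ _
    rw [pow_mul_taylorTail m hd, sub_sub]
    -- After multiplication by `z ^ m`, the `m` removed terms and the `N` shifted ones together form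
    -- the Taylor polynomial with `N + m` terms.
    have h3 : ∑ j ∈ Finset.range m, taylorCoeff (fockProj φ) j * z ^ j +
        ∑ n ∈ Finset.range N, taylorCoeff (fockProj φ) (n + m) * z ^ (m + n) =
        ∑ j ∈ Finset.range (N + m), taylorCoeff (fockProj φ) j * z ^ j := by
      rw [add_comm N m, Finset.sum_range_add]
      simp only [add_comm]
    rw [h3, norm_mul, Complex.norm_real, Real.norm_of_nonneg hg.le, Pi.smul_apply, smul_eq_mul,
      hW, Real.norm_of_nonneg (by positivity), ← mul_assoc]
    gcongr
    exact norm_sub_taylor_le hd hB hR (N + m) z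
  rw [tendsto_iff_norm_sub_tendsto_zero]
  refine squeeze_zero (fun N => norm_nonneg _) hbound ?_
  have h1 : Filter.Tendsto (fun N : ℕ => ((1 : ℝ) / 2) ^ (N + m)) Filter.atTop (nhds 0) :=
    (Filter.tendsto_add_atTop_iff_nat m).2
      (tendsto_pow_atTop_nhds_zero_of_lt_one (by norm_num) (by norm_num))
  simpa using ((h1.const_mul B).mul_const (eLpNorm W p volume).toReal).const_mul (fockConst p m)

/-- From `(ρ|z|) ^ (n + m) ≤ (n + m)! exp (ρ|z|)`. Since `ρ` is arbitrary, `‖z ^ n‖ / (n + m)!`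
decays faster than any geometric sequence, which makes the representing series converge everywhere.
-/
theorem exists_norm_monomial_le (p : ℝ≥0∞) [hp : Fact (1 ≤ p)] (m : ℕ) {ρ : ℝ} (hρ : 0 ≤ ρ) :
    ∃ κ : ℝ, ∀ n, ‖monomial p m n‖ * ρ ^ (n + m) ≤ κ * (n + m).factorial := by
  set W : ℂ → ℝ := fun z => Real.exp (ρ * ‖z‖) * sqrtGaussian z with hW
  have hWm : MemLp W p volume := memLp_exp_mul_norm_mul_sqrtGaussian ρ p
  refine ⟨fockConst p m * (eLpNorm W p volume).toReal, fun n => ?_⟩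
  rw [norm_def, mul_assoc, mul_assoc]
  refine mul_le_mul_of_nonneg_left ?_ (fockConst_pos p m hp.out).le
  have h1 := eLpNorm_const_smul (((n + m).factorial : ℝ)) W p volume
  have h2 := eLpNorm_const_smul (ρ ^ (n + m)) (fockWeighted m (monomial p m n)) p volume
  have e1 : (eLpNorm W p volume).toReal * (n + m).factorial =
      (eLpNorm (((n + m).factorial : ℝ) • W) p volume).toReal := by
    rw [h1, ENNReal.toReal_mul, toReal_enorm, Real.norm_of_nonneg (by positivity), mul_comm]
  have e2 : (eLpNorm (fockWeighted m (monomial p m n)) p volume).toReal * ρ ^ (n + m) =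
      (eLpNorm (ρ ^ (n + m) • fockWeighted m (monomial p m n)) p volume).toReal := by
    rw [h2, ENNReal.toReal_mul, toReal_enorm, Real.norm_of_nonneg (by positivity), mul_comm]
  rw [e1, e2]
  refine ENNReal.toReal_mono (hWm.const_smul _).2.ne (eLpNorm_mono fun z => ?_)
  have hg := sqrtGaussian_pos z
  have h3 := Real.pow_div_factorial_le_exp (ρ * ‖z‖) (by positivity) (n + m)
  rw [div_le_iff₀' (by positivity)] at h3
  rw [Pi.smul_apply, Pi.smul_apply, norm_smul, fockWeighted_eq, smul_eq_mul, hW,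
    Real.norm_of_nonneg (by positivity), Real.norm_of_nonneg (by positivity), norm_mul,
    Complex.norm_real, Real.norm_of_nonneg hg.le]
  change _ * (‖z ^ m * z ^ n‖ * _) ≤ _
  rw [← pow_add, norm_pow, add_comm m n, ← mul_assoc, ← mul_assoc, ← mul_pow]
  gcongr

theorem toReal_eLpNorm_fockWeighted (f : FockSobolev p m) :
    (eLpNorm (fockWeighted m f) p volume).toReal = (fockConst p m)⁻¹ * ‖f‖ := by
  rw [norm_def, inv_mul_cancel_left₀ (fockConst_pos p m hp.out).ne']

/-! ### The entire function representing a functional -/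

/-- The Taylor coefficients of the function which represents the functional `L`. -/
def reprCoeff (L : StrongDual ℂ (FockSobolev p m)) (n : ℕ) : ℂ :=
  (Real.pi : ℂ)⁻¹ * (conj (L (monomial p m n)) / (n + m).factorial)

theorem summable_reprCoeff (L : StrongDual ℂ (FockSobolev p m)) (z : ℂ) :
    Summable fun n => reprCoeff L n * z ^ n := by
  -- This choice gives `‖z‖ / ρ ≤ 1 / 2`, hence comparison with a geometric series.
  set ρ := 2 * (‖z‖ + 1) with hρ
  have hρ0 : 0 < ρ := by positivity
  obtain ⟨κ, hκ⟩ := exists_norm_monomial_le p m hρ0.le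
  refine Summable.of_norm_bounded (g := fun n : ℕ => Real.pi⁻¹ * ‖L‖ * κ * (ρ ^ m)⁻¹ * (1 / 2) ^ n)
    (Summable.mul_left _ summable_geometric_two) fun n => ?_
  have h1 : ‖L (monomial p m n)‖ / (n + m).factorial ≤ ‖L‖ * (κ * (ρ ^ (n + m))⁻¹) := by
    rw [div_le_iff₀ (by positivity)]
    refine (L.le_opNorm _).trans ?_
    rw [mul_assoc]
    refine mul_le_mul_of_nonneg_left ?_ (norm_nonneg _)
    rw [mul_right_comm, ← div_eq_mul_inv, le_div_iff₀ (by positivity)]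
    exact hκ n
  have h2 : ‖z‖ ^ n ≤ ρ ^ n * (1 / 2) ^ n := by
    rw [← mul_pow]
    gcongr
    rw [hρ]
    linarith
  have h3 : 0 ≤ ‖L‖ * (κ * (ρ ^ (n + m))⁻¹) := le_trans (by positivity) h1
  rw [reprCoeff, norm_mul, norm_mul, norm_div, norm_pow, norm_inv, Complex.norm_real,
    RCLike.norm_conj, Complex.norm_natCast, Real.norm_of_nonneg Real.pi_pos.le]
  have := Real.pi_pos
  calc _ ≤ Real.pi⁻¹ * (‖L‖ * (κ * (ρ ^ (n + m))⁻¹)) * (ρ ^ n * (1 / 2) ^ n) := by gcongr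
    _ = _ := by
      rw [pow_add]
      field_simp

/-- The entire function which represents the functional `L`. -/
def reprFun (L : StrongDual ℂ (FockSobolev p m)) (z : ℂ) : ℂ := ∑' n, reprCoeff L n * z ^ n

theorem differentiable_reprFun (L : StrongDual ℂ (FockSobolev p m)) :
    Differentiable ℂ (reprFun L) :=
  differentiable_tsum_mul_pow (summable_reprCoeff L)

/-- Bounded support of `φ` permits integration term by term. The `n`-th moment integral is `(n +
m)!` times a Taylor coefficient of `fockProj φ`; the factorial cancels against `reprCoeff`, and
continuity of `L` sums the series. -/
theorem integral_mul_conj_reprFun (L : StrongDual ℂ (FockSobolev p m)) {φ : ℂ → ℂ}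
    (hφ : IsBddSupported φ) :
    ∫ w, φ w * conj (fockWeighted m (reprFun L) w) =
      (Real.pi : ℂ)⁻¹ * L (ofLp m φ (hφ.memLp p)) := by
  have ht := (hφ.memLp p).gaussTame hp.out
  obtain ⟨R, hR0, hR⟩ := hφ.support
  set F : ℕ → ℂ → ℂ := fun n w =>
    conj (reprCoeff L n) * (φ w * (conj w ^ (n + m) * sqrtGaussian w)) with hF
  have hi : Integrable fun w => ‖φ w‖ * sqrtGaussian w := by simpa using ht.2 0
  have hFle : ∀ n w, ‖F n w‖ ≤
      ‖reprCoeff L n * (R : ℂ) ^ n‖ * R ^ m * (‖φ w‖ * sqrtGaussian w) := by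
    intro n w
    have hg := sqrtGaussian_pos w
    rw [hF]
    simp only [norm_mul, norm_pow, RCLike.norm_conj, Complex.norm_real, Real.norm_of_nonneg hg.le,
      Real.norm_of_nonneg hR0]
    by_cases hw : ‖w‖ ≤ R
    · calc _ ≤ ‖reprCoeff L n‖ * (‖φ w‖ * (R ^ (n + m) * sqrtGaussian w)) := by gcongr
        _ = _ := by rw [pow_add]; ring
    · simp [hR w (not_le.1 hw)]
  have hFm : ∀ n, Integrable (F n) := fun n =>
    (hi.const_mul _).mono' ((ht.1.mul (by fun_prop)).const_mul _)
      (Filter.Eventually.of_forall (hFle n))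
  have hsum : Summable fun n => ∫ w, ‖F n w‖ := by
    refine Summable.of_nonneg_of_le (fun n => integral_nonneg fun w => norm_nonneg _)
      (fun n => ?_) (((summable_reprCoeff L (R : ℂ)).norm.mul_right (R ^ m)).mul_right
        (∫ w, ‖φ w‖ * sqrtGaussian w))
    rw [← integral_const_mul]
    exact integral_mono (hFm n).norm (hi.const_mul _) (hFle n)
  have h1 := hasSum_integral_of_summable_integral_norm hFm hsum
  have e1 : ∀ w, ∑' n, F n w = φ w * conj (fockWeighted m (reprFun L) w) := by
    intro w
    have h2 := ((summable_reprCoeff L w).hasSum.mul_left (w ^ m)).mul_right (sqrtGaussian w : ℂ)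
    have h3 := (Complex.hasSum_conj'.2 h2).mul_left (φ w)
    rw [fockWeighted_eq, reprFun, ← h3.tsum_eq]
    refine tsum_congr fun n => ?_
    simp only [hF, map_mul, map_pow, Complex.conj_ofReal, pow_add]
    ring
  have e2 : ∀ n, ∫ w, F n w =
      (Real.pi : ℂ)⁻¹ * L (taylorCoeff (fockProj φ) (n + m) • monomial p m n) := by
    intro n
    rw [hF, integral_const_mul, ← ht.iteratedDeriv_fockProj_zero, map_smul, taylorCoeff, reprCoeff]
    simp only [map_mul, map_div₀, map_inv₀, Complex.conj_ofReal, Complex.conj_conj, smul_eq_mul,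
      Complex.conj_natCast]
    ring
  simp only [e1, e2] at h1
  have h2 := ((L.continuous.tendsto _).comp (tendsto_sum_monomial (p := p) (m := m) hφ)).const_mul
    (Real.pi : ℂ)⁻¹
  refine tendsto_nhds_unique h1.tendsto_sum_nat (h2.congr fun N => ?_)
  simp only [Function.comp_apply, map_sum, Finset.mul_sum]

/-! ### The duality -/

section Duality

variable [hq : Fact (1 ≤ q)] [hpq : ENNReal.HolderConjugate p q]

/-- The functional given by the integral pairing with `g`. -/
def dualPairing (g : FockSobolev q m) : StrongDual ℂ (FockSobolev p m) :=
  LinearMap.mkContinuous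
    { toFun := fun f => ∫ z, fockWeighted m f z * conj (fockWeighted m g z)
      map_add' := fun f₁ f₂ => by
        simp only [toFun_add, fockWeighted_add, Pi.add_apply, add_mul]
        exact integral_add (integrable_pairing f₁ g) (integrable_pairing f₂ g)
      map_smul' := fun a f => by
        simp only [toFun_smul, fockWeighted_smul, Pi.smul_apply, smul_eq_mul, mul_assoc,
          RingHom.id_apply]
        exact integral_const_mul _ _ }
    ((fockConst p m)⁻¹ * (fockConst q m)⁻¹ * ‖g‖) fun f => by
      refine (norm_integral_mul_conj_fockWeighted_le f.memLp g).trans (le_of_eq ?_)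
      rw [toReal_eLpNorm_fockWeighted, toReal_eLpNorm_fockWeighted]
      ring

theorem dualPairing_apply (g : FockSobolev q m) (f : FockSobolev p m) :
    dualPairing g f = ∫ z, fockWeighted m f z * conj (fockWeighted m g z) := rfl

theorem norm_dualPairing_le (g : FockSobolev q m) :
    ‖(dualPairing g : StrongDual ℂ (FockSobolev p m))‖ ≤
      (fockConst p m)⁻¹ * (fockConst q m)⁻¹ * ‖g‖ := by
  refine LinearMap.mkContinuous_norm_le _ ?_ _
  have h1 := fockConst_pos p m hp.out
  have h2 := fockConst_pos q m hq.out
  positivity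

/-- The conjugate-linear map from `g` to the pairing with `g`. -/
def dualMap : FockSobolev q m →ₗ⋆[ℂ] StrongDual ℂ (FockSobolev p m) where
  toFun := dualPairing
  map_add' g₁ g₂ := by
    ext f
    simp only [add_apply, dualPairing_apply, toFun_add, fockWeighted_add,
      Pi.add_apply, map_add, mul_add]
    exact integral_add (integrable_pairing f g₁) (integrable_pairing f g₂)
  map_smul' a g := by
    ext f
    simp only [smul_apply, dualPairing_apply, toFun_smul, fockWeighted_smul,
      Pi.smul_apply, smul_eq_mul, map_mul, mul_left_comm _ (conj a)]
    exact integral_const_mul _ _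

/-- Pairings with monomials are, up to conjugation and factorials, the Taylor coefficients of order
at least `m` of `fockProj (fockWeighted m g)`, which is `π z ^ m g`. -/
theorem dualMap_injective :
    Function.Injective (dualMap : FockSobolev q m →ₗ⋆[ℂ] StrongDual ℂ (FockSobolev p m)) := by
  rw [injective_iff_map_eq_zero]
  intro g hg
  have hc : ∀ n, taylorCoeff (fockProj (fockWeighted m g)) (n + m) = 0 := by
    intro n
    have h0 : ∫ z, fockWeighted m (monomial p m n) z * conj (fockWeighted m g z) = 0 :=
      DFunLike.congr_fun hg (monomial p m n)
    have h1 := congrArg conj h0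
    rw [← integral_conj, map_zero] at h1
    rw [taylorCoeff, (g.memLp.gaussTame hq.out).iteratedDeriv_fockProj_zero, div_eq_zero_iff]
    left
    rw [← h1]
    refine integral_congr_ae (Filter.Eventually.of_forall fun z => ?_)
    simp only [fockWeighted_eq m (monomial p m n).toFun, map_mul, Complex.conj_conj, map_pow,
      Complex.conj_ofReal]
    rw [show (monomial p m n).toFun z = z ^ n from rfl, map_pow]
    ring
  have h2 : (Real.pi : ℂ) • g = 0 := by
    rw [← ofLp_fockWeighted]
    refine toFun_injective ?_
    funext z
    change taylorTail m (fockProj (fockWeighted m g)) z = 0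
    simp [taylorTail, hc]
  exact (smul_eq_zero.1 h2).resolve_left (by exact_mod_cast Real.pi_ne_zero)

/-- Every functional on `F^{p,m}` is the pairing with an element of `F^{q,m}` whose norm is
controlled by the norm of the functional. -/
theorem exists_dualPairing_eq (p q : ℝ≥0∞) [hp : Fact (1 ≤ p)] [hq : Fact (1 ≤ q)]
    [ENNReal.HolderConjugate p q] (hpt : p ≠ ∞) (m : ℕ) :
    ∃ C : ℝ, ∀ L : StrongDual ℂ (FockSobolev p m),
      ∃ g : FockSobolev q m, dualPairing g = L ∧ ‖g‖ ≤ C * ‖L‖ := by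
  obtain ⟨C, hC0, hC⟩ := exists_norm_ofLp_le p m
  have hpi : (Real.pi : ℂ) ≠ 0 := by exact_mod_cast Real.pi_ne_zero
  refine ⟨fockConst q m * (Real.pi⁻¹ * C), fun L => ?_⟩
  have hA0 : 0 ≤ Real.pi⁻¹ * C * ‖L‖ := by
    have := Real.pi_pos
    positivity
  have hv := continuous_fockWeighted m (differentiable_reprFun L).continuous
  -- A priori `reprFun L` is only entire; membership in `F^{q,m}` and the norm bound come together
  -- from testing against bounded functions of bounded support.
  have hle : eLpNorm (fockWeighted m (reprFun L)) q volume ≤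
      ENNReal.ofReal (Real.pi⁻¹ * C * ‖L‖) := by
    refine eLpNorm_le_of_forall_integral_le hpt hv hA0 fun φ hφ => ?_
    rw [integral_mul_conj_reprFun L hφ, norm_mul, norm_inv, Complex.norm_real,
      Real.norm_of_nonneg Real.pi_pos.le]
    have h1 := L.le_opNorm (ofLp m φ (hφ.memLp p))
    have h2 := hC φ (hφ.memLp p)
    have := Real.pi_pos
    calc _ ≤ Real.pi⁻¹ * (‖L‖ * (C * (eLpNorm φ p volume).toReal)) := by
          gcongr
          exact h1.trans (by gcongr)
      _ = _ := by ring
  set g : FockSobolev q m := ⟨reprFun L, differentiable_reprFun L, hv.aestronglyMeasurable,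
    hle.trans_lt ENNReal.ofReal_lt_top⟩ with hg
  refine ⟨g, ?_, ?_⟩
  · ext f
    set u := fockWeighted m f with hu
    set D := (eLpNorm (fockWeighted m g) q volume).toReal with hD
    -- The identity of `integral_mul_conj_reprFun` holds for compactly supported continuous `ψ`. It
    -- passes to `u`, for which `ofLp m u = π • f`, because both sides are continuous for the `L^p`
    -- norm and such `ψ` are dense when `p ≠ ∞`.
    have hdiff : ∀ ε : ℝ, 0 < ε → ‖Real.pi * dualPairing g f - Real.pi * L f‖ ≤
        (Real.pi * D + ‖L‖ * C) * ε := by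
      intro ε hε
      obtain ⟨ψ, hψs, hψε, hψc, hψm⟩ := f.memLp.exists_hasCompactSupport_eLpNorm_sub_le hpt
        (ENNReal.ofReal_pos.2 hε).ne'
      have hψ := hψs.isBddSupported hψc
      have hε' : (eLpNorm (u - ψ) p volume).toReal ≤ ε :=
        ENNReal.toReal_le_of_le_ofReal hε.le hψε
      have h1 : (Real.pi : ℂ) * ∫ w, ψ w * conj (fockWeighted m g w) = L (ofLp m ψ hψm) := by
        have := integral_mul_conj_reprFun L hψ
        rw [hg]
        change (Real.pi : ℂ) * ∫ w, ψ w * conj (fockWeighted m (reprFun L) w) = _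
        rw [this, mul_inv_cancel_left₀ hpi]
      have h2 : Real.pi * L f = L (ofLp m u f.memLp) := by
        rw [ofLp_fockWeighted, map_smul, smul_eq_mul]
      have h3 : ∫ w, (u - ψ) w * conj (fockWeighted m g w) =
          dualPairing g f - ∫ w, ψ w * conj (fockWeighted m g w) := by
        rw [dualPairing_apply, ← integral_sub (integrable_pairing f g)
          (memLp_one_iff_integrable.1 (MemLp.mul' g.memLp_conj_fockWeighted hψm))]
        simp only [Pi.sub_apply, sub_mul, hu]
      have h4 : Real.pi * dualPairing g f - Real.pi * L f =
          Real.pi * (∫ w, (u - ψ) w * conj (fockWeighted m g w)) -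
            L (ofLp m (u - ψ) (f.memLp.sub hψm)) := by
        rw [h3, mul_sub, h1, h2, ofLp_sub f.memLp hψm, map_sub]
        ring
      rw [h4]
      refine (norm_sub_le _ _).trans ?_
      rw [add_mul, norm_mul, Complex.norm_real, Real.norm_of_nonneg Real.pi_pos.le]
      have hpi0 := Real.pi_pos
      have hD0 : 0 ≤ D := ENNReal.toReal_nonneg
      refine add_le_add ?_ ?_
      · rw [mul_assoc]
        refine mul_le_mul_of_nonneg_left
          ((norm_integral_mul_conj_fockWeighted_le (f.memLp.sub hψm) g).trans ?_) hpi0.le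
        rw [mul_comm]
        gcongr
      · rw [mul_assoc]
        refine (L.le_opNorm _).trans (mul_le_mul_of_nonneg_left ((hC _ _).trans ?_) (norm_nonneg _))
        gcongr
    have h0 : ‖Real.pi * dualPairing g f - Real.pi * L f‖ ≤ 0 := by
      refine le_of_forall_pos_le_add fun δ hδ => ?_
      have hK : 0 ≤ Real.pi * D + ‖L‖ * C :=
        add_nonneg (mul_nonneg Real.pi_pos.le ENNReal.toReal_nonneg) (mul_nonneg (norm_nonneg _) hC0)
      refine (hdiff (δ / (Real.pi * D + ‖L‖ * C + 1)) (by positivity)).trans ?_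
      rw [zero_add, mul_div_assoc', div_le_iff₀ (by positivity)]
      nlinarith
    rw [norm_le_zero_iff, sub_eq_zero] at h0
    exact mul_left_cancel₀ hpi h0
  · rw [norm_def, mul_assoc]
    exact mul_le_mul_of_nonneg_left (ENNReal.toReal_le_of_le_ofReal hA0 hle)
      (fockConst_pos q m hq.out).le

end Duality

end FockSobolev

end

/-! ### The characterization and the dual space -/

theorem theorem13 (m : ℕ) (hm : 0 < m) (p q : ℝ≥0∞) [Fact (1 ≤ p)] [Fact (1 ≤ q)]
    (hp : p ≠ ∞) (hpq : 1 / p + 1 / q = 1) :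
    (∀ f : ℂ → ℂ, MemFockSobolev p m f ↔ ∃ F : FockSobolev p m, F.toFun = f) ∧
    (∀ g : ℂ → ℂ, MemFockSobolev q m g ↔ ∃ G : FockSobolev q m, G.toFun = g) ∧
    (∀ (f : FockSobolev p m) (g : FockSobolev q m),
      Integrable (fun z : ℂ =>
        f z * conj (g z) * (Real.exp (-‖z‖ ^ 2) : ℂ) * (‖z‖ : ℂ) ^ (2 * m)) volume) ∧
    ∃ Φ : FockSobolev q m ≃L⋆[ℂ] StrongDual ℂ (FockSobolev p m),
      ∀ (g : FockSobolev q m) (f : FockSobolev p m),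
        Φ g f = ∫ z : ℂ,
          f z * conj (g z) * (Real.exp (-‖z‖ ^ 2) : ℂ) * (‖z‖ : ℂ) ^ (2 * m) := by
  have hc : ENNReal.HolderConjugate p q := ⟨by simpa using hpq⟩
  refine ⟨memFockSobolev_iff hm Fact.out, memFockSobolev_iff hm Fact.out, fun f g => ?_, ?_⟩
  · simp only [FockSobolev.pairing_eq]
    exact FockSobolev.integrable_pairing f g
  obtain ⟨C, hC⟩ := FockSobolev.exists_dualPairing_eq p q hp m
  have hsurj : Function.Surjective
      (FockSobolev.dualMap : FockSobolev q m →ₗ⋆[ℂ] StrongDual ℂ (FockSobolev p m)) :=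
    fun L => (hC L).imp fun g hg => hg.1
  set e : FockSobolev q m ≃ₗ⋆[ℂ] StrongDual ℂ (FockSobolev p m) :=
    LinearEquiv.ofBijective FockSobolev.dualMap ⟨FockSobolev.dualMap_injective, hsurj⟩ with he
  refine ⟨e.toContinuousLinearEquivOfBounds ((fockConst p m)⁻¹ * (fockConst q m)⁻¹) C
    (fun g => FockSobolev.norm_dualPairing_le g) (fun L => ?_), fun g f => ?_⟩
  -- By injectivity the inverse image of `L` is the representing function that carries the norm
  -- bound, so the inverse is bounded without the open mapping theorem.
  · obtain ⟨g, hg, hgC⟩ := hC L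
    have h : e.symm L = g := (LinearEquiv.symm_apply_eq e).2 hg.symm
    rw [h]
    exact hgC
  · simp only [FockSobolev.pairing_eq]
    rfl
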